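/- All Banach spaces are real. For a metric space $M$ with a base point $0\in M$, let $\mathrm{Lip}_0(M,\mathbb R)$ be the Banach space of Lipschitz functions $f\colon M\to\mathbb R$ with $f(0)=0$, normed by $\|f\|_L=\sup\{|f(x)-f(y)|/d(x,y): x\neq y\}$, and let $\operatorname{SNA}(M,\mathbb R)$ be the set of those $f\in\mathrm{Lip}_0(M,\mathbb R)$ for which this supremum is attained at some pair $x\ne y$. The Lipschitz-free space $\mathcal F(M)$ is the norm-closed linear span in $\mathrm{Lip}_0(M,\mathbb R)^*$ of the evaluation functionals $\delta(x)\colon f\mapsto f(x)$, $x\in M$. A Banach space $X$ has (Lindenstrauss) property A if for every Banach space $W$ the operators $T\in\mathcal L(X,W)$ such that $\|T\|=\|Tx\|$ for some $x\in X$ with $\|x\|=1$ are dense in $\mathcal L(X,W)$. A point $x_0\in C\subseteq X$ is a strongly exposed point of $C$ if there is $x^*\in X^*$ with $x^*(x_0)=\sup_{x\in C}x^*(x)$ such that $x_n\to x_0$ in norm for every sequence $(x_n)$ in $C$ with $x^*(x_n)\to x^*(x_0)$. (i) Let $\mathbb T$ be the unit circle of the Euclidean plane with the inherited Euclidean metric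 and any base point. Then $\mathcal F(\mathbb T)$ is separable and fails property A, while its closed unit ball is the closed convex hull of the set of its strongly exposed points. (ii) If $M$ is a separable complete metric space with a base point and $\mathcal F(M)$ has property A, then $\operatorname{SNA}(M,\mathbb R)$ is dense in $\mathrm{Lip}_0(M,\mathbb R)$. -/

import Mathlib

open Filter Topology

/-! Real Lipschitz functions on a metric space that vanish at a base point. -/

/-- The vector space of real Lipschitz functions on `M` that vanish at the base point `o`. -/
def lipZeroSubmodule {M : Type*} [MetricSpace M] (o : M) : Submodule ℝ (M → ℝ) where
  carrier := {f | f o = 0 ∧ ∃ K, LipschitzWith K f}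
  zero_mem' := ⟨rfl, 0, LipschitzWith.const 0⟩
  add_mem' := by
    rintro f g ⟨hf, K, hK⟩ ⟨hg, L, hL⟩
    exact ⟨by simp [hf, hg], K + L, hK.add hL⟩
  smul_mem' := by
    rintro c f ⟨hf, K, hK⟩
    refine ⟨by simp [hf], ‖c‖₊ * K, ?_⟩
    exact (lipschitzWith_smul c).comp hK

/-- The space `Lip₀(M, ℝ)` for the base point `o`. It is a type of its own, so that it carries
the Lipschitz norm and not the topology of pointwise convergence. -/
def LipZero {M : Type*} [MetricSpace M] (o : M) : Type _ := lipZeroSubmodule o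

namespace LipZero

variable {M : Type*} [MetricSpace M] {o : M}

instance : AddCommGroup (LipZero o) := inferInstanceAs (AddCommGroup (lipZeroSubmodule o))

instance : Module ℝ (LipZero o) := inferInstanceAs (Module ℝ (lipZeroSubmodule o))

instance : CoeFun (LipZero o) (fun _ => M → ℝ) := ⟨fun f => f.1⟩

/-- All the difference quotients of `f`. -/
def slopes (f : LipZero o) : Set ℝ := {r | ∃ x y : M, x ≠ y ∧ r = |f x - f y| / dist x y}

/-- The Lipschitz norm: the supremum of the difference quotients. -/
noncomputable instance : Norm (LipZero o) := ⟨fun f => sSup (slopes f)⟩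

theorem norm_def (f : LipZero o) : ‖f‖ = sSup (slopes f) := rfl

@[ext] theorem ext {f g : LipZero o} (h : ∀ x, f x = g x) : f = g := Subtype.ext (funext h)

@[simp] theorem add_apply (f g : LipZero o) (x : M) : (f + g) x = f x + g x := rfl

@[simp] theorem smul_apply (c : ℝ) (f : LipZero o) (x : M) : (c • f) x = c * f x := rfl

@[simp] theorem zero_apply (x : M) : (0 : LipZero o) x = 0 := rfl

@[simp] theorem base_apply (f : LipZero o) : f o = 0 := f.2.1

theorem bddAbove_slopes (f : LipZero o) : BddAbove (slopes f) := by
  obtain ⟨K, hK⟩ := f.2.2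
  refine ⟨K, ?_⟩
  rintro r ⟨x, y, hxy, rfl⟩
  rw [div_le_iff₀ (dist_pos.2 hxy), ← Real.dist_eq]
  exact hK.dist_le_mul x y

theorem norm_nonneg' (f : LipZero o) : 0 ≤ ‖f‖ := by
  refine Real.sSup_nonneg ?_
  rintro r ⟨x, y, -, rfl⟩
  positivity

theorem abs_sub_le (f : LipZero o) (x y : M) : |f x - f y| ≤ ‖f‖ * dist x y := by
  rcases eq_or_ne x y with rfl | hxy
  · simp
  · rw [← div_le_iff₀ (dist_pos.2 hxy)]
    exact le_csSup (bddAbove_slopes f) ⟨x, y, hxy, rfl⟩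

theorem norm_le_of_forall (f : LipZero o) {C : ℝ} (hC : 0 ≤ C)
    (h : ∀ x y, |f x - f y| ≤ C * dist x y) : ‖f‖ ≤ C := by
  refine Real.sSup_le ?_ hC
  rintro r ⟨x, y, hxy, rfl⟩
  rw [div_le_iff₀ (dist_pos.2 hxy)]
  exact h x y

theorem norm_smul_le' (c : ℝ) (f : LipZero o) : ‖c • f‖ ≤ |c| * ‖f‖ := by
  refine norm_le_of_forall _ (mul_nonneg (abs_nonneg c) (norm_nonneg' f)) fun x y => ?_
  have h := mul_le_mul_of_nonneg_left (abs_sub_le f x y) (abs_nonneg c)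
  rw [← abs_mul, mul_sub, ← mul_assoc] at h
  exact h

theorem core : NormedSpace.Core ℝ (LipZero o) where
  norm_nonneg := norm_nonneg'
  norm_smul c f := by
    refine le_antisymm (norm_smul_le' c f) ?_
    rcases eq_or_ne c 0 with rfl | hc
    · simpa using norm_nonneg' ((0 : ℝ) • f)
    · have h := norm_smul_le' c⁻¹ (c • f)
      rw [inv_smul_smul₀ hc, abs_inv, inv_mul_eq_div, le_div_iff₀ (abs_pos.2 hc)] at h
      rw [Real.norm_eq_abs, mul_comm]
      exact h
  norm_triangle f g := by
    refine norm_le_of_forall _ (add_nonneg (norm_nonneg' f) (norm_nonneg' g)) fun x y => ?_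
    have h : (f + g) x - (f + g) y = (f x - f y) + (g x - g y) := by
      simp only [add_apply]; ring
    rw [h, add_mul]
    exact (abs_add_le _ _).trans (add_le_add (abs_sub_le f x y) (abs_sub_le g x y))
  norm_eq_zero_iff f := by
    constructor
    · intro h
      ext x
      have h' := abs_sub_le f x o
      rw [h, zero_mul, base_apply, sub_zero] at h'
      simpa using h'
    · rintro rfl
      exact le_antisymm (norm_le_of_forall _ le_rfl fun x y => by simp) (norm_nonneg' 0)

noncomputable instance : NormedAddCommGroup (LipZero o) := NormedAddCommGroup.ofCore core

noncomputable instance : NormedSpace ℝ (LipZero o) := NormedSpace.ofCore core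

/-- The functions in `Lip₀(M, ℝ)` that strongly attain their norm. -/
def SNA {M : Type*} [MetricSpace M] (o : M) : Set (LipZero o) :=
  {f | ∃ x y : M, x ≠ y ∧ ‖f‖ = |f x - f y| / dist x y}

/-- The evaluation functional `δ(x)` on `Lip₀(M, ℝ)`. -/
noncomputable def delta {M : Type*} [MetricSpace M] (o x : M) : StrongDual ℝ (LipZero o) :=
  LinearMap.mkContinuous
    { toFun := fun f => f x
      map_add' := fun _ _ => rfl
      map_smul' := fun _ _ => rfl }
    (dist x o) (fun f => by
      have h := abs_sub_le f x o
      rw [base_apply, sub_zero, mul_comm] at h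
      exact h)

@[simp] theorem delta_apply (x : M) (f : LipZero o) : delta o x f = f x := rfl

end LipZero

/-- The Lipschitz-free space over `M` with base point `o`: the norm-closed linear span of the
evaluation functionals in the dual of `Lip₀(M, ℝ)`, with the dual norm. -/
noncomputable abbrev LipschitzFree {M : Type*} [MetricSpace M] (o : M) :
    Submodule ℝ (StrongDual ℝ (LipZero o)) :=
  (Submodule.span ℝ (Set.range (LipZero.delta o))).topologicalClosure

/-- The norm attaining operators from `X` to `W`. -/
def normAttaining (X W : Type*) [NormedAddCommGroup X] [NormedSpace ℝ X]
    [NormedAddCommGroup W] [NormedSpace ℝ W] : Set (X →L[ℝ] W) :=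
  {T | ∃ x : X, ‖x‖ = 1 ∧ ‖T‖ = ‖T x‖}

/-- Lindenstrauss' property A of a real Banach space `X`: for every real Banach space `W` the norm
attaining operators are dense in the operator norm. It is enough to let `W` range over the universe
of `X`, since the closure of the range of an operator on `X` has at most the cardinality of the
Banach space `X`. -/
def PropertyA.{u} (X : Type u) [NormedAddCommGroup X] [NormedSpace ℝ X] : Prop :=
  ∀ (W : Type u) [NormedAddCommGroup W] [NormedSpace ℝ W] [CompleteSpace W],
    Dense (normAttaining X W)

/-- The strongly exposed points of a set `C` in a real normed space. -/
def stronglyExposedPoints {X : Type*} [NormedAddCommGroup X] [NormedSpace ℝ X] (C : Set X) :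
    Set X :=
  {x₀ | x₀ ∈ C ∧ ∃ f : StrongDual ℝ X, (∀ x ∈ C, f x ≤ f x₀) ∧
    ∀ u : ℕ → X, (∀ n, u n ∈ C) → Tendsto (fun n => f (u n)) atTop (𝓝 (f x₀)) →
      Tendsto u atTop (𝓝 x₀)}

/-!
# Property A and strongly norm attaining Lipschitz functions

For the second part, let `X` be a separable Banach space with property A. Then the functionals that
strongly expose the unit ball are dense in the dual (`PropertyA.dense_stronglyExposes`). To get one
near a given `f₀ ≠ 0`, equip `X` with a locally uniformly rotund equivalent norm `N` whose
main part is a large multiple of `|f₀|` (`exists_lur_seminorm`), and approximate the identity of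
`X` into `(X, N)` by an operator `T` that attains its norm at some `x`. If `g` supports the ball of
`N` at `T x`, then `g ∘ T` strongly exposes the ball at `x` by rotundity, and `g ∘ T` is close to a
multiple of `f₀` by the choice of `N`. In a Lipschitz-free space the dual is the space of Lipschitz
functions and the ball is the closed convex hull of the molecules `(δ(x) - δ(y)) / d(x, y)`. A point
strongly exposed by a functional is therefore a norm limit of molecules, and over a complete `M`
such a limit is again given by a pair of points
(`IsLipschitzFree.exists_tendsto_of_cauchySeq_molecule`), at which the functional, as a Lipschitz
function, attains its norm.

On the circle the strongly norm attaining functions are not dense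
(`exists_forall_near_notMem_SNA`), so property A fails. A function that attains its norm at two
points must grow at nearly full speed along the arc between them, up to an error that is cubic in
the length of the arc. This excludes all functions near one that depends on the height through the
distribution function of a fat Cantor set whose gaps are large compared with the cubes of the
lengths of the intervals that contain them (`exists_gap_function`).

On the other hand every molecule of the circle is strongly exposed. In coordinates `P, Q` for which
the chord is the horizontal one at height `q`, the Lipschitz function `P - P * (Q - q) ^ 2 / 8`
peaks at its end points (`IsCircleChart.damped_peaks`), and a function that peaks at a pair strongly
exposes the molecule of the pair (`IsLipschitzFree.molecule_mem_stronglyExposedPoints`).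
-/

universe u

/-! ### Locally uniformly rotund renormings -/

/-- A copy of the vector space `X`, to be given another norm. -/
def Renormed (X : Type u) : Type u := X

instance (X : Type u) [AddCommGroup X] : AddCommGroup (Renormed X) := inferInstanceAs (AddCommGroup X)

instance (X : Type u) [AddCommGroup X] [Module ℝ X] : Module ℝ (Renormed X) :=
  inferInstanceAs (Module ℝ X)

/-- Property A, applied to the identity of `X` into `X` with an equivalent norm `N`, together with
a functional `g` that supports the ball of `N` at the point where the norm is attained. -/
theorem PropertyA.exists_attaining_renorming {X : Type u} [NormedAddCommGroup X] [NormedSpace ℝ X]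
    [CompleteSpace X] (hA : PropertyA X) (N : Seminorm ℝ X) {c C δ : ℝ} (hc : 0 < c)
    (hlow : ∀ x, c * ‖x‖ ≤ N x) (hup : ∀ x, N x ≤ C * ‖x‖) (hδ : 0 < δ) :
    ∃ (T : X →L[ℝ] X) (x : X) (g : StrongDual ℝ X), ‖x‖ = 1 ∧
      (∀ y, N (T y - y) ≤ δ * ‖y‖) ∧ (∀ y, N (T y) ≤ N (T x) * ‖y‖) ∧
      (∀ y, |g y| ≤ N y) ∧ g (T x) = N (T x) := by
  let _ : Norm (Renormed X) := ⟨fun x => N x⟩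
  have core : NormedSpace.Core ℝ (Renormed X) :=
    { norm_nonneg := fun x => apply_nonneg N x
      norm_smul := fun a x => map_smul_eq_mul N a x
      norm_triangle := fun x y => map_add_le_add N x y
      norm_eq_zero_iff := fun x => by
        constructor
        · intro h
          have h1 : N x = 0 := h
          have h2 : c * ‖(show X from x)‖ ≤ N x := hlow x
          rw [h1] at h2
          exact norm_le_zero_iff.1 (nonpos_of_mul_nonpos_right h2 hc)
        · rintro rfl
          exact map_zero N }
  let _ : NormedAddCommGroup (Renormed X) := NormedAddCommGroup.ofCore core
  let _ : NormedSpace ℝ (Renormed X) := NormedSpace.ofCore core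
  let e₀ : X ≃ₗ[ℝ] Renormed X := LinearEquiv.refl ℝ X
  let e : X ≃L[ℝ] Renormed X := e₀.toContinuousLinearEquivOfBounds C c⁻¹ hup (fun x => by
    rw [inv_mul_eq_div, le_div_iff₀ hc, mul_comm]
    exact hlow x)
  have : CompleteSpace (Renormed X) :=
    (completeSpace_congr (e := e.toEquiv) e.isUniformEmbedding).1 inferInstance
  obtain ⟨T, ⟨x, hx, hTx⟩, hT⟩ := Metric.dense_iff.1 (hA (Renormed X)) (e : X →L[ℝ] Renormed X) δ hδ
    |>.imp fun T h => And.symm h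
  rw [Metric.mem_ball, dist_eq_norm] at hT
  obtain ⟨g, hg1, hg2⟩ := exists_dual_vector'' ℝ (T x)
  refine ⟨(e.symm : Renormed X →L[ℝ] X).comp T, x, g.comp (e : X →L[ℝ] Renormed X), hx, ?_, ?_, ?_, ?_⟩
  · intro y
    exact ((T - (e : X →L[ℝ] Renormed X)).le_opNorm y).trans
      (mul_le_mul_of_nonneg_right hT.le (norm_nonneg y))
  · intro y
    have := T.le_opNorm y
    rw [hTx] at this
    exact this
  · intro y
    exact (g.le_of_opNorm_le hg1 (e y)).trans (one_mul _).le
  · exact hg2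

/-- The `ℓ²`-sum of a family of seminorms. -/
noncomputable def Seminorm.l2Sum {ι X : Type*} [AddCommGroup X] [Module ℝ X]
    (q : ι → Seminorm ℝ X) (hq : ∀ x, Summable fun i => q i x ^ 2) : Seminorm ℝ X :=
  Seminorm.of (fun x => √(∑' i, q i x ^ 2))
    (fun x y => by
      have h := Real.Lp_add_le_tsum_of_nonneg (p := 2) (f := fun i => q i x) (g := fun i => q i y)
        (by norm_num) (fun i => apply_nonneg _ _) (fun i => apply_nonneg _ _)
        (by simpa using hq x) (by simpa using hq y)
      simp only [Real.rpow_ofNat, ← Real.sqrt_eq_rpow] at h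
      refine le_trans (Real.sqrt_le_sqrt ?_) h.2
      refine (hq (x + y)).tsum_le_tsum (fun i => ?_) h.1
      exact pow_le_pow_left₀ (apply_nonneg _ _) (map_add_le_add _ _ _) 2)
    (fun a x => by
      simp only [map_smul_eq_mul, mul_pow, tsum_mul_left]
      rw [Real.sqrt_mul (by positivity), Real.sqrt_sq (norm_nonneg a)])

theorem Seminorm.l2Sum_sq {ι X : Type*} [AddCommGroup X] [Module ℝ X]
    {q : ι → Seminorm ℝ X} {hq : ∀ x, Summable fun i => q i x ^ 2} (x : X) :
    l2Sum q hq x ^ 2 = ∑' i, q i x ^ 2 :=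
  Real.sq_sqrt (tsum_nonneg fun _ => sq_nonneg _)

theorem Seminorm.le_l2Sum {ι X : Type*} [AddCommGroup X] [Module ℝ X]
    {q : ι → Seminorm ℝ X} {hq : ∀ x, Summable fun i => q i x ^ 2} (i : ι) (x : X) :
    q i x ≤ l2Sum q hq x := by
  refine Real.le_sqrt_of_sq_le ?_
  exact (hq x).le_tsum i fun _ _ => sq_nonneg _

/-- The convexity defect `2 q(x)² + 2 q(y)² - q(x + y)²` is nonnegative and adds up in an
`ℓ²`-sum, so the defect of the sum controls the defect of each summand. -/
theorem Seminorm.defect_le_l2Sum_defect {ι X : Type*} [AddCommGroup X] [Module ℝ X]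
    {q : ι → Seminorm ℝ X} {hq : ∀ x, Summable fun i => q i x ^ 2} (i : ι) (x y : X) :
    2 * q i x ^ 2 + 2 * q i y ^ 2 - q i (x + y) ^ 2 ≤
      2 * l2Sum q hq x ^ 2 + 2 * l2Sum q hq y ^ 2 - l2Sum q hq (x + y) ^ 2 := by
  simp only [l2Sum_sq]
  have hs := (((hq x).mul_left 2).add ((hq y).mul_left 2)).sub (hq (x + y))
  rw [← tsum_mul_left, ← tsum_mul_left, ← ((hq x).mul_left 2).tsum_add ((hq y).mul_left 2),
    ← (((hq x).mul_left 2).add ((hq y).mul_left 2)).tsum_sub (hq (x + y))]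
  refine hs.le_tsum i fun j _ => ?_
  have h1 := map_add_le_add (q j) x y
  have h2 := apply_nonneg (q j) (x + y)
  nlinarith [sq_nonneg (q j x - q j y)]

/-- Every separable normed space has, for each functional `f₀` and each `R`, a locally uniformly
rotund equivalent norm that dominates `R * |f₀|` and is bounded on the kernel of `f₀` independently
of `R`.

For a dense sequence `v n` with norming functionals `g n`, the norm is the `ℓ²`-sum of `R * |f₀|`
and of weighted copies of `|g n x|` and `‖x - g n x • w n‖`, where `w n` is the direction of `v n`.
If the defect of `N` at `x, y k` tends to zero, then so do the defects of these seminorms. With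
`v n` close to `x` the second seminorm is small at `x`, hence at `y k`, so both points are close to
their components along `w n`, which `g n` compares. -/
theorem exists_lur_seminorm {X : Type*} [NormedAddCommGroup X] [NormedSpace ℝ X]
    [TopologicalSpace.SeparableSpace X] (f₀ : StrongDual ℝ X) :
    ∃ c C : ℝ, 0 < c ∧ 0 ≤ C ∧ ∀ R : ℝ, 0 ≤ R → ∃ N : Seminorm ℝ X,
      (∀ x, c * ‖x‖ ≤ N x) ∧ (∀ x, N x ≤ R * |f₀ x| + C * ‖x‖) ∧ (∀ x, R * |f₀ x| ≤ N x) ∧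
      ∀ (x : X) (y : ℕ → X), Tendsto (fun k => N (y k)) atTop (𝓝 (N x)) →
        Tendsto (fun k => N (x + y k)) atTop (𝓝 (2 * N x)) → Tendsto y atTop (𝓝 x) := by
  obtain ⟨v, hv⟩ := TopologicalSpace.exists_dense_seq X
  choose g hg1 hg2 using fun n => exists_dual_vector'' ℝ (v n)
  simp only [RCLike.ofReal_real_eq_id, id] at hg2
  have hgle : ∀ n x, |g n x| ≤ ‖x‖ := fun n x =>
    ((g n).le_of_opNorm_le (hg1 n) x).trans (one_mul _).le
  let w : ℕ → X := fun n => ‖v n‖⁻¹ • v n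
  have hw : ∀ n, ‖w n‖ ≤ 1 := fun n => by
    simp only [w, norm_smul, norm_inv, norm_norm]
    exact inv_mul_le_one
  have hwv : ∀ n, ‖v n‖ • w n = v n := fun n => by
    rcases eq_or_ne (v n) 0 with h | h
    · simp [h]
    · exact smul_inv_smul₀ (norm_ne_zero_iff.2 h) _
  let A : ℕ → X →ₗ[ℝ] X := fun n => LinearMap.id - ((g n : X →ₗ[ℝ] ℝ).smulRight (w n))
  have hA : ∀ n x, A n x = x - g n x • w n := fun n x => rfl
  have hAle : ∀ n x, ‖A n x‖ ≤ 2 * ‖x‖ := fun n x => by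
    rw [hA]
    have h1 : ‖g n x • w n‖ ≤ ‖x‖ * 1 := by
      rw [norm_smul]
      exact mul_le_mul (hgle n x) (hw n) (norm_nonneg _) (norm_nonneg _)
    linarith [norm_sub_le x (g n x • w n)]
  let t : ℕ ⊕ ℕ → ℝ := fun i => √((1 / 2 : ℝ) ^ Encodable.encode i)
  have ht0 : ∀ i, 0 < t i := fun i => Real.sqrt_pos.2 (by positivity)
  have ht : ∀ i, t i ^ 2 = (1 / 2 : ℝ) ^ Encodable.encode i := fun i =>
    Real.sq_sqrt (by positivity)
  have hts : Summable fun i => t i ^ 2 := by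
    simp only [ht]
    exact summable_geometric_two_encode
  set B : ℝ := ∑' i, t i ^ 2 with hB
  have hB0 : 0 ≤ B := tsum_nonneg fun _ => sq_nonneg _
  let r : ℕ ⊕ ℕ → Seminorm ℝ X := fun i => Sum.casesOn i
    (fun n => (normSeminorm ℝ X).comp (t (Sum.inl n) • A n))
    (fun n => (normSeminorm ℝ ℝ).comp (t (Sum.inr n) • (g n : X →ₗ[ℝ] ℝ)))
  have hrl : ∀ n x, r (Sum.inl n) x = t (Sum.inl n) * ‖A n x‖ := fun n x => by
    simp [r, norm_smul, abs_of_pos (ht0 _)]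
  have hrr : ∀ n x, r (Sum.inr n) x = t (Sum.inr n) * |g n x| := fun n x => by
    simp [r, abs_of_pos (ht0 _)]
  have hr : ∀ i x, r i x ^ 2 ≤ t i ^ 2 * (4 * ‖x‖ ^ 2) := by
    rintro (n | n) x
    · rw [hrl, mul_pow]
      refine mul_le_mul_of_nonneg_left ?_ (sq_nonneg _)
      nlinarith [hAle n x, norm_nonneg (A n x), norm_nonneg x]
    · rw [hrr, mul_pow]
      refine mul_le_mul_of_nonneg_left ?_ (sq_nonneg _)
      nlinarith [hgle n x, abs_nonneg (g n x), norm_nonneg x]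
  have hrs : ∀ x, Summable fun i => r i x ^ 2 := fun x =>
    Summable.of_nonneg_of_le (fun _ => sq_nonneg _) (fun i => hr i x) (hts.mul_right _)
  have hrB : ∀ x, ∑' i, r i x ^ 2 ≤ B * (4 * ‖x‖ ^ 2) := fun x => by
    rw [hB, ← tsum_mul_right]
    exact (hrs x).tsum_le_tsum (fun i => hr i x) (hts.mul_right _)
  refine ⟨min (t (Sum.inl 0)) (t (Sum.inr 0)) / 2, 2 * √B, half_pos (lt_min (ht0 _) (ht0 _)),
    by positivity, fun R hR => ?_⟩
  obtain ⟨q, hq0, hqr⟩ : ∃ q : Option (ℕ ⊕ ℕ) → Seminorm ℝ X,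
      (∀ x, q none x = R * |f₀ x|) ∧ ∀ i, q (some i) = r i :=
    ⟨fun i => i.elim ((normSeminorm ℝ ℝ).comp (R • (f₀ : X →ₗ[ℝ] ℝ))) r,
      fun x => by simp [abs_of_nonneg hR], fun _ => rfl⟩
  have hq : ∀ x, HasSum (fun i => q i x ^ 2) ((R * |f₀ x|) ^ 2 + ∑' i, r i x ^ 2) := fun x => by
    have h1 : HasSum (fun i : Option (ℕ ⊕ ℕ) => if i = none then (R * |f₀ x|) ^ 2 else 0)
        ((R * |f₀ x|) ^ 2) := hasSum_ite_eq _ _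
    have h2 : HasSum (fun i : Option (ℕ ⊕ ℕ) => i.elim 0 fun j => r j x ^ 2)
        (∑' i, r i x ^ 2) := by
      refine ((Option.some_injective _).hasSum_iff ?_).1 (hrs x).hasSum
      rintro (_ | j) hj
      · rfl
      · exact absurd ⟨j, rfl⟩ hj
    convert h1.add h2 using 2 with i
    rcases i with _ | j
    · simp [hq0]
    · simp [hqr]
  let N := Seminorm.l2Sum q fun x => (hq x).summable
  have hNq : ∀ i x, q i x ≤ N x := fun i x => Seminorm.le_l2Sum i x
  refine ⟨N, fun x => ?_, fun x => ?_, fun x => ?_, fun x y h1 h2 => ?_⟩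
  · have h1 := hNq (some (Sum.inl 0)) x
    have h2 := hNq (some (Sum.inr 0)) x
    rw [hqr, hrl] at h1
    rw [hqr, hrr] at h2
    have h3 : ‖x‖ ≤ ‖A 0 x‖ + |g 0 x| := by
      have h4 : x = A 0 x + g 0 x • w 0 := by rw [hA]; abel
      calc ‖x‖ = ‖A 0 x + g 0 x • w 0‖ := by rw [← h4]
        _ ≤ ‖A 0 x‖ + ‖g 0 x • w 0‖ := norm_add_le _ _
        _ ≤ ‖A 0 x‖ + |g 0 x| := by
          rw [norm_smul]
          gcongr
          exact mul_le_of_le_one_right (norm_nonneg _) (hw 0)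
    set m := min (t (Sum.inl 0)) (t (Sum.inr 0))
    have hm : 0 ≤ m := le_min (ht0 _).le (ht0 _).le
    have h5 : m * ‖A 0 x‖ ≤ N x :=
      (mul_le_mul_of_nonneg_right (min_le_left _ _) (norm_nonneg _)).trans h1
    have h6 : m * |g 0 x| ≤ N x :=
      (mul_le_mul_of_nonneg_right (min_le_right _ _) (abs_nonneg _)).trans h2
    linarith [mul_le_mul_of_nonneg_left h3 hm]
  · refine le_of_sq_le_sq ?_ (by positivity)
    rw [Seminorm.l2Sum_sq, (hq x).tsum_eq]
    have h3 : (2 * √B * ‖x‖) ^ 2 = B * (4 * ‖x‖ ^ 2) := by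
      rw [mul_pow, mul_pow, Real.sq_sqrt hB0]; ring
    have h4 : 0 ≤ (R * |f₀ x|) * (2 * √B * ‖x‖) := by positivity
    nlinarith [hrB x]
  · exact (hq0 x).symm.le.trans (hNq none x)
  · have hdef : Tendsto (fun k => 2 * N x ^ 2 + 2 * N (y k) ^ 2 - N (x + y k) ^ 2) atTop (𝓝 0) := by
      have := ((tendsto_const_nhds (x := 2 * N x ^ 2)).add ((h1.pow 2).const_mul 2)).sub (h2.pow 2)
      convert this using 2
      ring
    have hi : ∀ i, Tendsto (fun k => 2 * q i x ^ 2 + 2 * q i (y k) ^ 2 - q i (x + y k) ^ 2)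
        atTop (𝓝 0) := fun i => by
      refine squeeze_zero (fun k => ?_) (fun k => Seminorm.defect_le_l2Sum_defect i x (y k)) hdef
      have h1 := map_add_le_add (q i) x (y k)
      have h2 := apply_nonneg (q i) (x + y k)
      nlinarith [sq_nonneg (q i x - q i (y k))]
    have hg : ∀ n, Tendsto (fun k => |g n (y k) - g n x|) atTop (𝓝 0) := fun n => by
      have h3 := (hi (some (Sum.inr n))).const_mul (t (Sum.inr n) ^ 2)⁻¹
      have h4 := h3.sqrt
      simp only [mul_zero, Real.sqrt_zero] at h4
      refine h4.congr fun k => ?_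
      rw [← Real.sqrt_sq_eq_abs]
      congr 1
      simp only [hqr, hrr, mul_pow, sq_abs, map_add]
      have := (ht0 (Sum.inr n)).ne'
      field_simp
      ring
    have hd : ∀ n, Tendsto (fun k => (‖A n x‖ - ‖A n (y k)‖) ^ 2) atTop (𝓝 0) := fun n => by
      have h3 := (hi (some (Sum.inl n))).const_mul (t (Sum.inl n) ^ 2)⁻¹
      rw [mul_zero] at h3
      refine squeeze_zero (fun _ => sq_nonneg _) (fun k => ?_) h3
      simp only [hqr, hrl, mul_pow]
      have := (ht0 (Sum.inl n)).ne'
      field_simp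
      rw [map_add]
      have h5 := norm_add_le (A n x) (A n (y k))
      nlinarith [norm_nonneg (A n x + A n (y k))]
    rw [Metric.tendsto_atTop']
    intro ε hε
    obtain ⟨n, hn⟩ := hv.exists_dist_lt x (show 0 < ε / 8 by positivity)
    rw [dist_eq_norm] at hn
    -- `A n` almost vanishes at `x`, since it vanishes at `v n`
    have hAx : ‖A n x‖ ≤ 2 * (ε / 8) := by
      have h3 : A n (v n) = 0 := by rw [hA, hg2, hwv, sub_self]
      have h4 := hAle n (x - v n)
      rw [map_sub, h3, sub_zero] at h4
      linarith
    have e1 := (hg n).eventually_lt_const (show 0 < ε / 8 by positivity)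
    have e2 := (hd n).eventually_lt_const (show 0 < (ε / 8) ^ 2 by positivity)
    obtain ⟨K, hK⟩ := (e1.and e2).exists_forall_of_atTop
    refine ⟨K, fun k hk => ?_⟩
    obtain ⟨h3, h4⟩ := hK k hk.le
    have h5 := abs_lt_of_sq_lt_sq h4 (by positivity)
    have h6 : y k - x = A n (y k) + (g n (y k) - g n x) • w n - A n x := by
      rw [hA, hA, sub_smul]; abel
    have h7 : ‖(g n (y k) - g n x) • w n‖ ≤ ε / 8 := by
      rw [norm_smul]
      exact (mul_le_of_le_one_right (norm_nonneg _) (hw n)).trans h3.le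
    rw [dist_eq_norm, h6]
    have h8 := norm_sub_le (A n (y k) + (g n (y k) - g n x) • w n) (A n x)
    have h9 := norm_add_le (A n (y k)) ((g n (y k) - g n x) • w n)
    have h10 := abs_lt.1 h5
    linarith [h10.1]

/-! ### Strongly exposing functionals and property A -/

/-- The functional `f` strongly exposes the closed unit ball at `x₀`. -/
def StronglyExposesBallAt {X : Type*} [NormedAddCommGroup X] [NormedSpace ℝ X]
    (f : StrongDual ℝ X) (x₀ : X) : Prop :=
  ‖x₀‖ ≤ 1 ∧ (∀ x : X, ‖x‖ ≤ 1 → f x ≤ f x₀) ∧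
    ∀ y : ℕ → X, (∀ n, ‖y n‖ ≤ 1) → Tendsto (fun n => f (y n)) atTop (𝓝 (f x₀)) →
      Tendsto y atTop (𝓝 x₀)

theorem StronglyExposesBallAt.smul {X : Type*} [NormedAddCommGroup X] [NormedSpace ℝ X]
    {f : StrongDual ℝ X} {x₀ : X} (h : StronglyExposesBallAt f x₀) {a : ℝ} (ha : 0 < a) :
    StronglyExposesBallAt (a • f) x₀ := by
  refine ⟨h.1, fun x hx => mul_le_mul_of_nonneg_left (h.2.1 x hx) ha.le, fun y hy hlim => ?_⟩
  refine h.2.2 y hy ?_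
  have := hlim.const_mul a⁻¹
  simpa [ha.ne'] using this

theorem StronglyExposesBallAt.neg {X : Type*} [NormedAddCommGroup X] [NormedSpace ℝ X]
    {f : StrongDual ℝ X} {x₀ : X} (h : StronglyExposesBallAt f x₀) :
    StronglyExposesBallAt (-f) (-x₀) := by
  refine ⟨by simpa using h.1, fun x hx => ?_, fun y hy hlim => ?_⟩
  · have := h.2.1 (-x) (by simpa using hx)
    simpa using this
  · have := h.2.2 (fun n => -y n) (by simpa using hy) (by simpa using hlim)
    simpa using this.neg

theorem StronglyExposesBallAt.exists_smul {X : Type*} [NormedAddCommGroup X] [NormedSpace ℝ X]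
    {f : StrongDual ℝ X} {x₀ : X} (h : StronglyExposesBallAt f x₀) {a : ℝ} (ha : a ≠ 0) :
    ∃ x₁, StronglyExposesBallAt (a • f) x₁ := by
  rcases ha.lt_or_gt with ha | ha
  · refine ⟨-x₀, ?_⟩
    have := (h.smul (neg_pos.2 ha)).neg
    have e : -(-a • f) = a • f := by
      ext v
      simp
    rwa [e] at this
  · exact ⟨x₀, h.smul ha⟩

/-- The pull-back of the supporting functional of `PropertyA.exists_attaining_renorming` strongly
exposes the ball, because the norm `N` is locally uniformly rotund. Since `N` is dominated by
`R * |f₀|` up to a bounded error, this functional is, after scaling, close to `f₀` for large `R`. -/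
theorem PropertyA.exists_stronglyExposes_near {X : Type u} [NormedAddCommGroup X] [NormedSpace ℝ X]
    [CompleteSpace X] [TopologicalSpace.SeparableSpace X] (hA : PropertyA X)
    {f₀ : StrongDual ℝ X} (hf₀ : f₀ ≠ 0) {ε : ℝ} (hε : 0 < ε) :
    ∃ f x, StronglyExposesBallAt f x ∧ ‖f - f₀‖ < ε := by
  obtain ⟨c, C, hc, hC, hN⟩ := exists_lur_seminorm f₀
  obtain ⟨z, hz⟩ : ∃ z, f₀ z = 1 := by
    obtain ⟨z, hz⟩ := DFunLike.ne_iff.1 hf₀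
    exact ⟨(f₀ z)⁻¹ • z, by simpa using inv_mul_cancel₀ hz⟩
  have hz0 : 0 < ‖z‖ := norm_pos_iff.2 (by rintro rfl; simp at hz)
  set C₁ := C * (1 + ‖f₀‖ * ‖z‖) with hC₁
  have hC₁0 : 0 ≤ C₁ := by positivity
  have hf₀n : 0 < ‖f₀‖ := norm_pos_iff.2 hf₀
  -- `R` is so large that the factor `a` below satisfies `C₁ + 1 < |a| * ε`
  set R := ‖z‖ * (C₁ + 2 + ‖f₀‖ * ((C₁ + 1) / ε + 1)) with hR
  have hR0 : 0 ≤ R := by positivity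
  obtain ⟨N, hlow, hup, hf₀N, hlur⟩ := hN R hR0
  have hup' : ∀ x, N x ≤ (R * ‖f₀‖ + C) * ‖x‖ := fun x => by
    have := mul_le_mul_of_nonneg_left (f₀.le_opNorm x) hR0
    rw [Real.norm_eq_abs] at this
    linarith [hup x]
  set δ := min 1 (c / 2) with hδ
  have hδ0 : 0 < δ := lt_min one_pos (half_pos hc)
  obtain ⟨T, x, g, hx, hT, hTx, hgN, hgx⟩ := hA.exists_attaining_renorming N hc hlow hup' hδ0
  have hTlow : ∀ y, c / 2 * ‖y‖ ≤ N (T y) := fun y => by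
    have h1 := hT y
    have h2 : N y ≤ N (T y) + N (T y - y) := by
      have := map_sub_le_add N (T y) (T y - y)
      simpa using this
    have h3 : δ * ‖y‖ ≤ c / 2 * ‖y‖ := mul_le_mul_of_nonneg_right (min_le_right _ _) (norm_nonneg _)
    linarith [hlow y]
  have hexp : StronglyExposesBallAt (g.comp T) x := by
    have hN1 : ∀ y, ‖y‖ ≤ 1 → N (T y) ≤ N (T x) := fun y hy =>
      (hTx y).trans (mul_le_of_le_one_right (apply_nonneg _ _) hy)
    refine ⟨hx.le, fun y hy => ?_, fun y hy hlim => ?_⟩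
    · change g (T y) ≤ g (T x)
      rw [hgx]
      exact (le_abs_self _).trans ((hgN _).trans (hN1 y hy))
    · change Tendsto (fun n => g (T (y n))) atTop (𝓝 (g (T x))) at hlim
      have hTy : Tendsto (fun n => T (y n)) atTop (𝓝 (T x)) := by
        rw [hgx] at hlim
        refine hlur (T x) _ ?_ ?_
        · exact tendsto_of_tendsto_of_tendsto_of_le_of_le hlim tendsto_const_nhds
            (fun n => (le_abs_self _).trans (hgN _)) (fun n => hN1 _ (hy n))
        · have h2 := hlim.const_add (N (T x))
          rw [← two_mul] at h2
          refine tendsto_of_tendsto_of_tendsto_of_le_of_le h2 tendsto_const_nhds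
            (fun n => ?_) (fun n => ?_)
          · have := (le_abs_self _).trans (hgN (T x + T (y n)))
            rwa [map_add, hgx] at this
          · have := map_add_le_add N (T x) (T (y n))
            have := hN1 _ (hy n)
            dsimp only
            linarith
      rw [tendsto_iff_norm_sub_tendsto_zero] at hTy ⊢
      have h3 := hTy.const_mul ((c / 2)⁻¹ * (R * ‖f₀‖ + C))
      rw [mul_zero] at h3
      refine squeeze_zero (fun _ => norm_nonneg _) (fun n => ?_) h3
      have h4 := (hTlow (y n - x)).trans (hup' _)
      rw [map_sub] at h4
      rw [mul_assoc, inv_mul_eq_div, le_div_iff₀ (half_pos hc), mul_comm]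
      exact h4
  -- on the kernel of `f₀` the functional `g` is small, so it is close to a multiple of `f₀`
  set a := g z with ha
  have hga : ∀ y, |g y - a * f₀ y| ≤ C₁ * ‖y‖ := fun y => by
    have h1 := (hgN (y - f₀ y • z)).trans (hup _)
    have h2 : f₀ (y - f₀ y • z) = 0 := by simp [hz]
    have h3 : ‖y - f₀ y • z‖ ≤ ‖y‖ + ‖f₀‖ * ‖y‖ * ‖z‖ := by
      refine (norm_sub_le _ _).trans ?_
      rw [norm_smul]
      gcongr
      exact f₀.le_opNorm y
    rw [h2, abs_zero, mul_zero, zero_add] at h1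
    have h4 : g (y - f₀ y • z) = g y - a * f₀ y := by simp [ha, mul_comm]
    rw [h4] at h1
    refine h1.trans ((mul_le_mul_of_nonneg_left h3 hC).trans (le_of_eq ?_))
    rw [hC₁]; ring
  have hgT : ∀ y, |g (T y) - g y| ≤ ‖y‖ := fun y => by
    rw [← map_sub]
    refine (hgN _).trans ((hT y).trans ?_)
    exact mul_le_of_le_one_left (norm_nonneg _) (min_le_left _ _)
  have hga' : ∀ y, |g (T y) - a * f₀ y| ≤ (C₁ + 1) * ‖y‖ := fun y => by
    have := abs_sub_le (g (T y)) (g y) (a * f₀ y)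
    linarith [hga y, hgT y]
  have hbig : (C₁ + 1) / ε + 1 ≤ |a| := by
    have h1 : R ≤ N z := by simpa [hz] using hf₀N z
    have h2 : N z ≤ N (T z) + ‖z‖ := by
      have h3 := map_sub_le_add N (T z) (T z - z)
      rw [sub_sub_cancel] at h3
      have h4 := (hT z).trans (mul_le_of_le_one_left (norm_nonneg z) (min_le_left _ _))
      linarith
    have h3 := hTx z
    have h4 := le_abs_self (g (T x) - a * f₀ x) |>.trans (hga' x)
    rw [hx, mul_one, hgx] at h4
    have h5 : a * f₀ x ≤ |a| * ‖f₀‖ := by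
      refine (le_abs_self _).trans ?_
      rw [abs_mul]
      have := f₀.le_opNorm x
      rw [hx, mul_one] at this
      exact mul_le_mul_of_nonneg_left this (abs_nonneg a)
    have h6 : ‖z‖ * (C₁ + 2 + ‖f₀‖ * ((C₁ + 1) / ε + 1)) ≤ ‖z‖ * (N (T x) + 1) := by
      rw [← hR]; linarith
    have h7 := le_of_mul_le_mul_left h6 hz0
    refine le_of_mul_le_mul_left (a := ‖f₀‖) ?_ hf₀n
    linarith
  have ha0 : 0 < |a| := lt_of_lt_of_le (by positivity) hbig
  obtain ⟨x₁, hx₁⟩ := hexp.exists_smul (inv_ne_zero (abs_pos.1 ha0))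
  refine ⟨_, x₁, hx₁, ?_⟩
  have h1 : ‖a⁻¹ • g.comp T - f₀‖ ≤ |a|⁻¹ * (C₁ + 1) := by
    refine ContinuousLinearMap.opNorm_le_bound _ (by positivity) fun y => ?_
    have h2 : (a⁻¹ • g.comp T - f₀) y = a⁻¹ * (g (T y) - a * f₀ y) := by
      have := abs_pos.1 ha0
      simp only [sub_apply, smul_apply,
        ContinuousLinearMap.comp_apply, smul_eq_mul]
      field_simp
    rw [h2, Real.norm_eq_abs, abs_mul, abs_inv, mul_assoc]
    exact mul_le_mul_of_nonneg_left (hga' y) (by positivity)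
  refine h1.trans_lt ?_
  rw [inv_mul_eq_div, div_lt_iff₀ ha0, ← div_lt_iff₀' hε]
  linarith

/-- In a separable Banach space with property A the functionals that strongly expose the unit
ball are dense. -/
theorem PropertyA.dense_stronglyExposes {X : Type u} [NormedAddCommGroup X] [NormedSpace ℝ X]
    [CompleteSpace X] [TopologicalSpace.SeparableSpace X] (hA : PropertyA X) :
    Dense {f : StrongDual ℝ X | ∃ x, StronglyExposesBallAt f x} := by
  have : Nontrivial X := by
    obtain ⟨T, -, x, hx, -⟩ := Metric.dense_iff.1 (hA X) 0 1 one_pos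
    exact ⟨x, 0, by rintro rfl; simp at hx⟩
  rw [← dense_closure]
  refine (dense_compl_singleton (0 : StrongDual ℝ X)).mono fun f₀ hf₀ => ?_
  rw [Metric.mem_closure_iff]
  intro ε hε
  obtain ⟨f, x, hf, hlt⟩ := hA.exists_stronglyExposes_near hf₀ hε
  exact ⟨f, ⟨x, hf⟩, by rwa [dist_comm, dist_eq_norm]⟩

/-! ### Molecules in Lipschitz-free spaces -/

section

variable {M : Type*} [MetricSpace M] {o : M} {X : Type*} [NormedAddCommGroup X] [NormedSpace ℝ X]

/-- The map `δ : M → X` exhibits the normed space `X` as (a dense subspace of) the Lipschitz-free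
space over `M`: it is `1`-Lipschitz, it spans a dense subspace, and every Lipschitz function on `M`
that vanishes at `o` extends along `δ` to a functional without increase of the norm. -/
structure IsLipschitzFree (o : M) (δ : M → X) : Prop where
  norm_sub_le : ∀ x y, ‖δ x - δ y‖ ≤ dist x y
  base_eq_zero : δ o = 0
  dense_span : Dense (Submodule.span ℝ (Set.range δ) : Set X)
  exists_extension : ∀ f : LipZero o, ∃ φ : StrongDual ℝ X, ‖φ‖ ≤ ‖f‖ ∧ ∀ x, φ (δ x) = f x

/-- The molecule `(δ(x) - δ(y)) / d(x, y)`. For `x = y` this is `0`. -/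
noncomputable def molecule (δ : M → X) (x y : M) : X := (dist x y)⁻¹ • (δ x - δ y)

theorem molecule_swap (δ : M → X) (x y : M) : molecule δ y x = -molecule δ x y := by
  rw [molecule, molecule, dist_comm, ← smul_neg, neg_sub]

theorem apply_molecule (δ : M → X) (φ : StrongDual ℝ X) (x y : M) :
    φ (molecule δ x y) = (φ (δ x) - φ (δ y)) / dist x y := by
  rw [molecule, map_smul, map_sub, smul_eq_mul, div_eq_inv_mul]

namespace IsLipschitzFree

variable {δ : M → X}

theorem norm_molecule_le (h : IsLipschitzFree o δ) (x y : M) : ‖molecule δ x y‖ ≤ 1 := by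
  rw [molecule, norm_smul, norm_inv, Real.norm_of_nonneg dist_nonneg]
  exact (mul_le_mul_of_nonneg_left (h.norm_sub_le x y) (by positivity)).trans inv_mul_le_one

/-- The Lipschitz function given by a functional on the Lipschitz-free space. -/
noncomputable def toLipZero (h : IsLipschitzFree o δ) (φ : StrongDual ℝ X) : LipZero o :=
  ⟨fun x => φ (δ x), by simp only [h.base_eq_zero, map_zero], ‖φ‖₊,
    LipschitzWith.of_dist_le_mul fun x y => by
      rw [dist_eq_norm, ← map_sub]
      exact (φ.le_opNorm _).trans
        (mul_le_mul_of_nonneg_left (h.norm_sub_le x y) (norm_nonneg φ))⟩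

@[simp] theorem toLipZero_apply (h : IsLipschitzFree o δ) (φ : StrongDual ℝ X) (x : M) :
    h.toLipZero φ x = φ (δ x) := rfl

theorem norm_toLipZero_le (h : IsLipschitzFree o δ) (φ : StrongDual ℝ X) :
    ‖h.toLipZero φ‖ ≤ ‖φ‖ := by
  refine LipZero.norm_le_of_forall _ (norm_nonneg φ) fun x y => ?_
  rw [toLipZero_apply, toLipZero_apply, ← map_sub]
  exact (φ.le_opNorm _).trans (mul_le_mul_of_nonneg_left (h.norm_sub_le x y) (norm_nonneg φ))

/-- Functionals on the Lipschitz-free space are determined by their values on the points, so the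
extension of `h.toLipZero φ` is `φ`. -/
theorem norm_le_norm_toLipZero (h : IsLipschitzFree o δ) (φ : StrongDual ℝ X) :
    ‖φ‖ ≤ ‖h.toLipZero φ‖ := by
  obtain ⟨ψ, hψ, hφψ⟩ := h.exists_extension (h.toLipZero φ)
  have : φ = ψ := ContinuousLinearMap.ext_on h.dense_span <| by
    rintro _ ⟨x, rfl⟩
    exact (hφψ x).symm
  rwa [this] at hψ ⊢

theorem apply_le_norm_toLipZero (h : IsLipschitzFree o δ) (φ : StrongDual ℝ X) (μ : X) :
    φ μ ≤ ‖h.toLipZero φ‖ * ‖μ‖ :=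
  (le_abs_self _).trans (φ.le_of_opNorm_le (h.norm_le_norm_toLipZero φ) μ)

theorem continuous (h : IsLipschitzFree o δ) : Continuous δ := by
  refine (LipschitzWith.of_dist_le_mul (K := 1) fun x y => ?_).continuous
  rw [dist_eq_norm, NNReal.coe_one, one_mul]
  exact h.norm_sub_le x y

theorem separableSpace [TopologicalSpace.SeparableSpace M] (h : IsLipschitzFree o δ) :
    TopologicalSpace.SeparableSpace X := by
  have := (TopologicalSpace.isSeparable_range h.continuous).span (R := ℝ).closure
  rw [h.dense_span.closure_eq] at this
  exact TopologicalSpace.isSeparable_univ_iff.1 this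

/-- The unit ball of the Lipschitz-free space is the closed convex hull of the molecules. -/
theorem closedBall_subset_closure_convexHull [Nontrivial M] (h : IsLipschitzFree o δ) :
    Metric.closedBall (0 : X) 1 ⊆
      closure (convexHull ℝ {m | ∃ x y : M, x ≠ y ∧ m = molecule δ x y}) := by
  set V : Set X := {m | ∃ x y : M, x ≠ y ∧ m = molecule δ x y}
  intro μ hμ
  by_contra hcon
  obtain ⟨φ, u, h1, h2⟩ :=
    geometric_hahn_banach_closed_point (convex_convexHull ℝ V).closure isClosed_closure hcon
  have hle : ∀ x y, h.toLipZero φ x - h.toLipZero φ y ≤ u * dist x y := fun x y => by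
    rcases eq_or_ne x y with rfl | hxy
    · simp
    · have := h1 _ (subset_closure (subset_convexHull ℝ V ⟨x, y, hxy, rfl⟩))
      rw [apply_molecule, div_lt_iff₀ (dist_pos.2 hxy)] at this
      exact this.le
  obtain ⟨x, y, hxy⟩ := exists_pair_ne M
  have hd := dist_pos.2 hxy
  have hu : 0 ≤ u := by
    have h3 := hle x y
    have h4 := hle y x
    rw [dist_comm] at h4
    nlinarith
  have hn : ‖h.toLipZero φ‖ ≤ u := LipZero.norm_le_of_forall _ hu fun x y => by
    rw [abs_le]
    have := hle y x
    rw [dist_comm] at this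
    exact ⟨by linarith, hle x y⟩
  rw [mem_closedBall_zero_iff] at hμ
  have h5 := h.apply_le_norm_toLipZero φ μ
  have h6 : ‖h.toLipZero φ‖ * ‖μ‖ ≤ u * 1 := mul_le_mul hn hμ (norm_nonneg _) hu
  linarith

/-- The function `z ↦ max (d(x, y) - d(z, x)) 0`, shifted to vanish at the base point. It is
normed by the pair `x, y`. -/
noncomputable def bump (o x y : M) : LipZero o :=
  ⟨fun z => max (dist x y - dist z x) 0 - max (dist x y - dist o x) 0, sub_self _, 1, by
    refine LipschitzWith.of_dist_le_mul fun z w => ?_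
    rw [NNReal.coe_one, one_mul, Real.dist_eq, sub_sub_sub_cancel_right]
    refine (abs_max_sub_max_le_abs _ _ _).trans ?_
    rw [sub_sub_sub_cancel_left, abs_sub_comm]
    exact abs_dist_sub_le z w x⟩

theorem norm_bump_le (x y : M) : ‖bump o x y‖ ≤ 1 := by
  refine LipZero.norm_le_of_forall _ zero_le_one fun z w => ?_
  change |max (dist x y - dist z x) 0 - max (dist x y - dist o x) 0 -
    (max (dist x y - dist w x) 0 - max (dist x y - dist o x) 0)| ≤ _
  rw [one_mul, sub_sub_sub_cancel_right]
  refine (abs_max_sub_max_le_abs _ _ _).trans ?_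
  rw [sub_sub_sub_cancel_left, abs_sub_comm]
  exact abs_dist_sub_le z w x

/-- Molecules that are close in norm have close first end points and comparable lengths. Testing
the difference on `bump o x y` gives this without any bound on the lengths from below. -/
theorem dist_le_of_norm_molecule_sub_le (h : IsLipschitzFree o δ) {x y u v : M} (hxy : x ≠ y) (huv : u ≠ v) {ε : ℝ}
    (hε : ε < 1) (hm : ‖molecule δ x y - molecule δ u v‖ ≤ ε) :
    (1 - ε) * dist u v ≤ dist x y - dist u x := by
  have hD := dist_pos.2 hxy
  have hD' := dist_pos.2 huv
  obtain ⟨φ, hφ, hφb⟩ := h.exists_extension (bump o x y)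
  have h1 := φ.le_opNorm (molecule δ x y - molecule δ u v)
  have h2 : ‖φ‖ * ‖molecule δ x y - molecule δ u v‖ ≤ 1 * ε :=
    mul_le_mul (hφ.trans (norm_bump_le x y)) hm (norm_nonneg _) zero_le_one
  have h3 : φ (molecule δ x y - molecule δ u v) =
      (max (dist x y) 0 - 0) / dist x y -
      (max (dist x y - dist u x) 0 - max (dist x y - dist v x) 0) / dist u v := by
    rw [map_sub, apply_molecule, apply_molecule, hφb, hφb, hφb, hφb]
    change (max (dist x y - dist x x) 0 - max (dist x y - dist o x) 0 -
      (max (dist x y - dist y x) 0 - max (dist x y - dist o x) 0)) / dist x y -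
      (max (dist x y - dist u x) 0 - max (dist x y - dist o x) 0 -
      (max (dist x y - dist v x) 0 - max (dist x y - dist o x) 0)) / dist u v = _
    rw [dist_self, dist_comm y x, sub_self, sub_zero, max_self, sub_sub_sub_cancel_right,
      sub_sub_sub_cancel_right]
  rw [h3, max_eq_left hD.le, sub_zero, div_self hD.ne'] at h1
  have h4 := (le_abs_self _).trans (h1.trans h2)
  have h5 : (1 - ε) * dist u v ≤
      max (dist x y - dist u x) 0 - max (dist x y - dist v x) 0 := by
    rw [← le_div_iff₀ hD']
    linarith
  have h6 := le_max_right (dist x y - dist v x) 0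
  have h7 : 0 < (1 - ε) * dist u v := mul_pos (by linarith) hD'
  rcases max_cases (dist x y - dist u x) 0 with ⟨h8, -⟩ | ⟨h8, -⟩ <;> linarith

/-- In a complete metric space the limit of a norm-convergent sequence of molecules comes from
limits of the end points. -/
theorem exists_tendsto_of_cauchySeq_molecule [CompleteSpace M] (h : IsLipschitzFree o δ) {x y : ℕ → M}
    (hxy : ∀ n, x n ≠ y n) (hc : CauchySeq fun n => molecule δ (x n) (y n)) :
    ∃ a b, a ≠ b ∧ Tendsto x atTop (𝓝 a) ∧ Tendsto y atTop (𝓝 b) := by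
  rw [Metric.cauchySeq_iff] at hc
  obtain ⟨n₀, hn₀⟩ := hc (1 / 2) (by norm_num)
  have hup : ∀ n ≥ n₀, dist (x n) (y n) ≤ 2 * dist (x n₀) (y n₀) := fun n hn => by
    have h1 := hn₀ n₀ le_rfl n hn
    rw [dist_eq_norm] at h1
    have h2 := h.dist_le_of_norm_molecule_sub_le (hxy n₀) (hxy n) (by norm_num) h1.le
    have := dist_nonneg (x := x n) (y := x n₀)
    linarith
  have hlow : ∀ n ≥ n₀, dist (x n₀) (y n₀) / 2 ≤ dist (x n) (y n) := fun n hn => by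
    have h1 := hn₀ n hn n₀ le_rfl
    rw [dist_eq_norm] at h1
    have h2 := h.dist_le_of_norm_molecule_sub_le (hxy n) (hxy n₀) (by norm_num) h1.le
    have := dist_nonneg (x := x n₀) (y := x n)
    linarith
  have hd0 : 0 < dist (x n₀) (y n₀) := dist_pos.2 (hxy n₀)
  have key : ∀ {x y : ℕ → M}, (∀ n, x n ≠ y n) → ∀ D > 0, (∀ n ≥ n₀, dist (x n) (y n) ≤ D) →
      (∀ ε > 0, ∃ N, ∀ m ≥ N, ∀ n ≥ N, ‖molecule δ (x m) (y m) - molecule δ (x n) (y n)‖ < ε) →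
      CauchySeq x := by
    intro x y hxy D hD hup hc
    rw [Metric.cauchySeq_iff]
    intro ε hε
    set η := min (1 / 2) (ε / (4 * D)) with hη
    have hη0 : 0 < η := by positivity
    have hη1 : η ≤ 1 / 2 := min_le_left _ _
    have hηε : η * (4 * D) ≤ ε := by
      rw [← le_div_iff₀ (by positivity)]
      exact min_le_right _ _
    obtain ⟨N, hN⟩ := hc η hη0
    refine ⟨max N n₀, fun m hm n hn => ?_⟩
    have hm1 := le_of_max_le_left hm
    have hn1 := le_of_max_le_left hn
    have h1 := h.dist_le_of_norm_molecule_sub_le (hxy n) (hxy m) (by linarith) (hN n hn1 m hm1).le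
    have h2 := h.dist_le_of_norm_molecule_sub_le (hxy m) (hxy n) (by linarith) (hN m hm1 n hn1).le
    rw [dist_comm (x n) (x m)] at h2
    have h3 : (1 - η) * ((1 - η) * dist (x n) (y n)) ≤ (1 - η) * dist (x m) (y m) :=
      mul_le_mul_of_nonneg_left (by linarith [dist_nonneg (x := x m) (y := x n)]) (by linarith)
    have h4 := dist_pos.2 (hxy n)
    have h5 : η * dist (x n) (y n) ≤ η * D :=
      mul_le_mul_of_nonneg_left (hup n (le_of_max_le_right hn)) hη0.le
    have h6 : 0 ≤ η * η * dist (x n) (y n) := by positivity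
    have h7 : 0 < η * D := by positivity
    nlinarith
  have hcx : CauchySeq x := key hxy _ (by positivity) hup fun ε hε => by
    simpa only [dist_eq_norm] using hc ε hε
  have hcy : CauchySeq y := by
    refine key (fun n => (hxy n).symm) (2 * dist (x n₀) (y n₀)) (by positivity)
      (fun n hn => by rw [dist_comm]; exact hup n hn) fun ε hε => ?_
    obtain ⟨N, hN⟩ := hc ε hε
    refine ⟨N, fun m hm n hn => ?_⟩
    have := hN n hn m hm
    rw [dist_eq_norm] at this
    rwa [molecule_swap δ (x m), molecule_swap δ (x n), neg_sub_neg]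
  obtain ⟨a, ha⟩ := cauchySeq_tendsto_of_complete hcx
  obtain ⟨b, hb⟩ := cauchySeq_tendsto_of_complete hcy
  refine ⟨a, b, ?_, ha, hb⟩
  have h1 := ge_of_tendsto (ha.dist hb) (eventually_atTop.2 ⟨n₀, hlow⟩)
  exact dist_pos.1 (by linarith)

/-- Molecules norm every functional. For a strongly exposing functional a norming sequence of
molecules converges, and the end points of the limit are a pair where the norm is attained. -/
theorem toLipZero_mem_SNA_of_stronglyExposes [CompleteSpace M] [Nontrivial M] (h : IsLipschitzFree o δ)
    {φ : StrongDual ℝ X} {μ : X} (hφ : StronglyExposesBallAt φ μ) :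
    h.toLipZero φ ∈ LipZero.SNA o := by
  set f := h.toLipZero φ with hf
  have hex : ∀ n : ℕ, ∃ x y : M, x ≠ y ∧ ‖f‖ - 1 / ((n : ℝ) + 1) < φ (molecule δ x y) := by
    intro n
    obtain ⟨a, b, hab⟩ := exists_pair_ne M
    have hlt : ‖f‖ - 1 / ((n : ℝ) + 1) < sSup (LipZero.slopes f) :=
      sub_lt_self _ (by positivity)
    obtain ⟨_, ⟨x, y, hxy, rfl⟩, h1⟩ := exists_lt_of_lt_csSup
      (show (LipZero.slopes f).Nonempty from ⟨_, a, b, hab, rfl⟩) hlt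
    rcases abs_cases (f x - f y) with ⟨h2, -⟩ | ⟨h2, -⟩ <;> rw [h2] at h1
    · exact ⟨x, y, hxy, by rwa [apply_molecule]⟩
    · exact ⟨y, x, hxy.symm, by rwa [apply_molecule, dist_comm, ← neg_sub (φ (δ x))]⟩
  choose x y hxy hlt using hex
  have hle : ∀ n, φ (molecule δ (x n) (y n)) ≤ φ μ := fun n => hφ.2.1 _ (h.norm_molecule_le _ _)
  have hμ : φ μ ≤ ‖f‖ := (h.apply_le_norm_toLipZero φ μ).trans
    (mul_le_of_le_one_right (norm_nonneg _) hφ.1)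
  have hlim : Tendsto (fun n : ℕ => ‖f‖ - 1 / ((n : ℝ) + 1)) atTop (𝓝 ‖f‖) := by
    simpa using tendsto_one_div_add_atTop_nhds_zero_nat.const_sub ‖f‖
  have hmol : Tendsto (fun n => φ (molecule δ (x n) (y n))) atTop (𝓝 ‖f‖) :=
    tendsto_of_tendsto_of_tendsto_of_le_of_le hlim tendsto_const_nhds (fun n => (hlt n).le)
      fun n => (hle n).trans hμ
  have hμf : φ μ = ‖f‖ := le_antisymm hμ (le_of_tendsto' hmol hle)
  have hconv := hφ.2.2 _ (fun n => h.norm_molecule_le (x n) (y n)) (hμf ▸ hmol)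
  obtain ⟨a, b, hab, ha, hb⟩ := h.exists_tendsto_of_cauchySeq_molecule hxy hconv.cauchySeq
  refine ⟨a, b, hab, ?_⟩
  have hcont : Continuous f := f.2.2.choose_spec.continuous
  have h1 := (((hcont.tendsto a).comp ha).sub ((hcont.tendsto b).comp hb)).div (ha.dist hb)
    (dist_pos.2 hab).ne'
  have h2 : ‖f‖ = (f a - f b) / dist a b :=
    tendsto_nhds_unique hmol (h1.congr fun n => (apply_molecule δ φ _ _).symm)
  refine le_antisymm (h2.le.trans ?_) (le_csSup (LipZero.bddAbove_slopes f) ⟨a, b, hab, rfl⟩)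
  exact div_le_div_of_nonneg_right (le_abs_self _) dist_nonneg

/-- Property A makes the strongly exposing functionals dense in the dual `Lip₀(M, ℝ)`, and these
strongly attain their norm. -/
theorem dense_SNA_of_propertyA {X : Type u} [NormedAddCommGroup X] [NormedSpace ℝ X]
    [CompleteSpace X] {δ : M → X} [CompleteSpace M] [TopologicalSpace.SeparableSpace M]
    (h : IsLipschitzFree o δ) (hA : PropertyA X) : Dense (LipZero.SNA o) := by
  have := h.separableSpace
  have : Nontrivial M := by
    obtain ⟨T, -, μ, hμ, -⟩ := Metric.dense_iff.1 (hA X) 0 1 one_pos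
    by_contra hM
    rw [not_nontrivial_iff_subsingleton] at hM
    have hr : Set.range δ ⊆ {0} := by
      rintro _ ⟨x, rfl⟩
      rw [Subsingleton.elim x o, h.base_eq_zero, Set.mem_singleton_iff]
    have h0 := h.dense_span μ
    rw [Submodule.span_eq_bot.2 fun x hx => hr hx, Submodule.bot_coe, closure_singleton] at h0
    simp [Set.mem_singleton_iff.1 h0] at hμ
  intro f
  rw [Metric.mem_closure_iff]
  intro ε hε
  obtain ⟨ψ, -, hψ⟩ := h.exists_extension f
  obtain ⟨φ, ⟨μ, hφ⟩, hlt⟩ := Metric.mem_closure_iff.1 (hA.dense_stronglyExposes ψ) ε hε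
  refine ⟨h.toLipZero φ, h.toLipZero_mem_SNA_of_stronglyExposes hφ, ?_⟩
  have h1 : f - h.toLipZero φ = h.toLipZero (ψ - φ) := by
    rw [sub_eq_iff_eq_add]
    refine LipZero.ext fun x => ?_
    rw [LipZero.add_apply, toLipZero_apply, toLipZero_apply, sub_apply, hψ, sub_add_cancel]
  rw [dist_eq_norm] at hlt ⊢
  rw [h1]
  exact (h.norm_toLipZero_le _).trans_lt hlt

/-- If a Lipschitz function of norm one peaks at the pair `x, y`, then it strongly exposes the
molecule of that pair. -/
theorem molecule_mem_stronglyExposedPoints (h : IsLipschitzFree o δ) {f : LipZero o} (hf : ‖f‖ ≤ 1) {x y : M} (hxy : x ≠ y)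
    (hfxy : f x - f y = dist x y)
    (hpeak : ∀ η > 0, ∃ κ > 0, ∀ u v : M, u ≠ v → (1 - κ) * dist u v < f u - f v →
      dist u x < η ∧ dist v y < η) :
    molecule δ x y ∈ stronglyExposedPoints (Metric.closedBall (0 : X) 1) := by
  have : Nontrivial M := ⟨x, y, hxy⟩
  have hD := dist_pos.2 hxy
  obtain ⟨φ, hφ, hφf⟩ := h.exists_extension f
  have hone : φ (molecule δ x y) = 1 := by
    rw [apply_molecule, hφf, hφf, hfxy, div_self hD.ne']
  have hle : ∀ μ ∈ Metric.closedBall (0 : X) 1, φ μ ≤ 1 := fun μ hμ => by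
    rw [mem_closedBall_zero_iff] at hμ
    refine (le_abs_self _).trans ((φ.le_opNorm μ).trans ?_)
    exact mul_le_one₀ (hφ.trans hf) (norm_nonneg μ) hμ
  have hmol : ∀ u v : M, u ≠ v → dist x y * ‖molecule δ u v - molecule δ x y‖ ≤
      2 * (dist u x + dist v y) := fun u v huv => by
    have h1 : dist x y • (molecule δ u v - molecule δ x y) =
        (dist x y - dist u v) • molecule δ u v +
          ((δ u - δ x) - (δ v - δ y)) := by
      rw [smul_sub, sub_smul, molecule, molecule, smul_inv_smul₀ hD.ne',
        smul_inv_smul₀ (dist_pos.2 huv).ne']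
      abel
    have h2 : ‖(dist x y - dist u v) • molecule δ u v‖ ≤ dist u x + dist v y := by
      rw [norm_smul, Real.norm_eq_abs, ← Real.dist_eq, dist_comm u x, dist_comm v y]
      exact (mul_le_of_le_one_right dist_nonneg (h.norm_molecule_le u v)).trans
        (dist_dist_dist_le x y u v)
    have h3 := _root_.norm_sub_le (δ u - δ x) (δ v - δ y)
    have h4 := h.norm_sub_le u x
    have h5 := h.norm_sub_le v y
    calc dist x y * ‖molecule δ u v - molecule δ x y‖
        = ‖dist x y • (molecule δ u v - molecule δ x y)‖ := by
          rw [norm_smul, Real.norm_of_nonneg hD.le]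
      _ ≤ _ := by
          rw [h1]
          refine (norm_add_le _ _).trans ?_
          linarith
  have hball : molecule δ x y ∈ Metric.closedBall (0 : X) 1 :=
    mem_closedBall_zero_iff.2 (h.norm_molecule_le x y)
  -- the bound holds for molecules, and the points that satisfy it form a closed convex set
  have key : ∀ ε > 0, ∃ K : ℝ, ∀ μ ∈ Metric.closedBall (0 : X) 1,
      ‖μ - molecule δ x y‖ ≤ ε + K * (1 - φ μ) := by
    intro ε hε
    obtain ⟨κ, hκ, hp⟩ := hpeak (ε * dist x y / 4) (by positivity)
    refine ⟨2 / κ, fun μ hμ => ?_⟩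
    have hconv : Convex ℝ {μ : X |
        dist μ (molecule δ x y) + ((2 / κ) • φ) μ ≤ ε + 2 / κ} := by
      have := ((convexOn_dist (molecule δ x y) convex_univ).add
        (((2 / κ) • φ).toLinearMap.convexOn convex_univ)).convex_le (ε + 2 / κ)
      simpa using this
    have hclosed : IsClosed {μ : X |
        dist μ (molecule δ x y) + ((2 / κ) • φ) μ ≤ ε + 2 / κ} :=
      isClosed_le (by fun_prop) continuous_const
    have hmem := closure_minimal (convexHull_min ?_ hconv) hclosed
      (h.closedBall_subset_closure_convexHull hμ)
    · have h1 : dist μ (molecule δ x y) + 2 / κ * φ μ ≤ ε + 2 / κ := hmem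
      rw [dist_eq_norm] at h1
      linarith
    · rintro _ ⟨u, v, huv, rfl⟩
      change dist (molecule δ u v) (molecule δ x y) + 2 / κ * φ (molecule δ u v) ≤
        ε + 2 / κ
      have hφ1 := hle _ (mem_closedBall_zero_iff.2 (h.norm_molecule_le u v))
      have hK : 0 < 2 / κ := by positivity
      rw [dist_eq_norm]
      by_cases hcase : 1 - κ < φ (molecule δ u v)
      · have h1 := hcase
        rw [apply_molecule, hφf, hφf, lt_div_iff₀ (dist_pos.2 huv)] at h1
        obtain ⟨h2, h3⟩ := hp u v huv h1
        have h4 : dist x y * ‖molecule δ u v - molecule δ x y‖ ≤ dist x y * ε := by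
          linarith [hmol u v huv]
        have h5 := le_of_mul_le_mul_left h4 hD
        have h6 := mul_le_mul_of_nonneg_left hφ1 hK.le
        linarith
      · have h1 : ‖molecule δ u v - molecule δ x y‖ ≤ 2 := by
          have := _root_.norm_sub_le (molecule δ u v) (molecule δ x y)
          linarith [h.norm_molecule_le u v, h.norm_molecule_le x y]
        have h2 : 2 / κ * φ (molecule δ u v) ≤ 2 / κ * (1 - κ) :=
          mul_le_mul_of_nonneg_left (not_lt.1 hcase) hK.le
        have h3 : 2 / κ * (1 - κ) = 2 / κ - 2 := by field_simp
        linarith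
  refine ⟨hball, φ, fun μ hμ => hone ▸ hle μ hμ, fun ν hν hlim => ?_⟩
  rw [hone] at hlim
  rw [Metric.tendsto_atTop']
  intro ε hε
  obtain ⟨K, hK⟩ := key (ε / 2) (half_pos hε)
  have h1 : Tendsto (fun n => ε / 2 + K * (1 - φ (ν n))) atTop (𝓝 (ε / 2)) := by
    simpa using ((hlim.const_sub 1).const_mul K).const_add (ε / 2)
  obtain ⟨n₀, hn₀⟩ := (h1.eventually_lt_const (half_lt_self hε)).exists_forall_of_atTop
  refine ⟨n₀, fun n hn => ?_⟩
  rw [dist_eq_norm]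
  exact (hK _ (hν n)).trans_lt (hn₀ n hn.le)

end IsLipschitzFree

end

/-- The concrete Lipschitz-free space, with the evaluation functionals, is a Lipschitz-free space
in the sense of `IsLipschitzFree`. -/
theorem isLipschitzFree_delta {M : Type*} [MetricSpace M] (o : M) :
    IsLipschitzFree o fun x => (⟨LipZero.delta o x,
      subset_closure (Submodule.subset_span ⟨x, rfl⟩)⟩ : LipschitzFree o) where
  norm_sub_le x y := by
    refine ContinuousLinearMap.opNorm_le_bound _ dist_nonneg fun f => ?_
    exact (LipZero.abs_sub_le f x y).trans (mul_comm _ _).le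
  base_eq_zero := Subtype.ext (ContinuousLinearMap.ext fun f => LipZero.base_apply f)
  dense_span := by
    intro μ
    rw [Topology.IsInducing.subtypeVal.closure_eq_preimage_closure_image, Set.mem_preimage]
    have h := Submodule.map_span (LipschitzFree o).subtype (Set.range fun x =>
      (⟨LipZero.delta o x, subset_closure (Submodule.subset_span ⟨x, rfl⟩)⟩ : LipschitzFree o))
    rw [← Set.range_comp] at h
    exact closure_mono (SetLike.coe_subset_coe.2 h.ge) μ.2
  exists_extension f := by
    refine ⟨(ContinuousLinearMap.apply ℝ ℝ f).comp (LipschitzFree o).subtypeL, ?_, fun x => rfl⟩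
    refine ContinuousLinearMap.opNorm_le_bound _ (norm_nonneg f) fun μ => ?_
    rw [mul_comm]
    exact μ.1.le_opNorm f

instance {M : Type*} [MetricSpace M] (o : M) : CompleteSpace (LipschitzFree o) :=
  (Submodule.isClosed_topologicalClosure _).completeSpace_coe

/-! ### Strongly exposed molecules of the circle -/

/-- Coordinates `P, Q` that identify a metric space with a subset of the Euclidean unit circle. -/
structure IsCircleChart {M : Type*} [MetricSpace M] (P Q : M → ℝ) : Prop where
  sq_add_sq : ∀ u, P u ^ 2 + Q u ^ 2 = 1
  dist_sq : ∀ u v, dist u v ^ 2 = (P u - P v) ^ 2 + (Q u - Q v) ^ 2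

namespace IsCircleChart

/-- The coordinate `P`, damped away from the line `Q = q`. On the circle it has Lipschitz
constant one and is normed by the chord on that line only. -/
noncomputable def damped {α : Type*} (P Q : α → ℝ) (q : ℝ) (u : α) : ℝ := P u - P u * (Q u - q) ^ 2 / 8

theorem damped_sub {α : Type*} (P Q : α → ℝ) (q : ℝ) (u v : α) : damped P Q q u - damped P Q q v =
    (P u - P v) * (1 - ((Q u - q) ^ 2 + (Q v - q) ^ 2) / 16) +
      (Q u - Q v) * (-((P u + P v) * (Q u - q + (Q v - q))) / 16) := by
  rw [damped, damped]; ring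

variable {M : Type*} [MetricSpace M] {P Q : M → ℝ}

theorem abs_fst_le (h : IsCircleChart P Q) (u : M) : |P u| ≤ 1 :=
  abs_le_one_iff_mul_self_le_one.2 (by linarith [h.sq_add_sq u, sq_nonneg (Q u)])

theorem abs_snd_le (h : IsCircleChart P Q) (u : M) : |Q u| ≤ 1 :=
  abs_le_one_iff_mul_self_le_one.2 (by linarith [h.sq_add_sq u, sq_nonneg (P u)])

theorem sq_damped_sub_le (h : IsCircleChart P Q) {q : ℝ} (hq : |q| ≤ 1) (u v : M) :
    (damped P Q q u - damped P Q q v) ^ 2 ≤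
      dist u v ^ 2 * (1 - ((Q u - q) ^ 2 + (Q v - q) ^ 2) / 16) := by
  rw [damped_sub, h.dist_sq]
  set A := P u - P v
  set B := Q u - Q v
  set S := (Q u - q) ^ 2 + (Q v - q) ^ 2 with hS
  set r := -((P u + P v) * (Q u - q + (Q v - q))) / 16 with hr
  have hsq : ∀ w, (Q w - q) ^ 2 ≤ 2 ^ 2 := fun w => by
    rw [sq_le_sq, abs_of_pos (two_pos : (0 : ℝ) < 2)]
    linarith [abs_sub (Q w) q, h.abs_snd_le w]
  have hS0 : 0 ≤ S := by positivity
  have hS8 : S ≤ 8 := by linarith [hsq u, hsq v]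
  have h1 : (P u + P v) ^ 2 ≤ 2 ^ 2 := by
    rw [sq_le_sq, abs_of_pos (two_pos : (0 : ℝ) < 2)]
    linarith [abs_add_le (P u) (P v), h.abs_fst_le u, h.abs_fst_le v]
  have h2 : (Q u - q + (Q v - q)) ^ 2 ≤ 2 * S := by linarith [sq_nonneg (Q u - q - (Q v - q))]
  have h3 : r ^ 2 ≤ S / 32 := by
    have : (P u + P v) ^ 2 * (Q u - q + (Q v - q)) ^ 2 ≤ 4 * (2 * S) :=
      mul_le_mul (h1.trans (by norm_num)) h2 (sq_nonneg _) (by norm_num)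
    have h4 : r ^ 2 = (P u + P v) ^ 2 * (Q u - q + (Q v - q)) ^ 2 / 256 := by rw [hr]; ring
    linarith
  have h4 : (A * (1 - S / 16) + B * r) ^ 2 ≤ (A ^ 2 + B ^ 2) * ((1 - S / 16) ^ 2 + r ^ 2) := by
    linarith [sq_nonneg (A * r - B * (1 - S / 16))]
  refine h4.trans (mul_le_mul_of_nonneg_left ?_ (by positivity))
  nlinarith

theorem abs_damped_sub_le (h : IsCircleChart P Q) {q : ℝ} (hq : |q| ≤ 1) (u v : M) :
    |damped P Q q u - damped P Q q v| ≤ dist u v := by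
  refine abs_le_of_sq_le_sq ((h.sq_damped_sub_le hq u v).trans ?_) dist_nonneg
  refine mul_le_of_le_one_right (sq_nonneg _) ?_
  linarith [sq_nonneg (Q u - q), sq_nonneg (Q v - q)]

/-- On one side of the axis `P = 0` the points are determined, continuously, by `Q`. -/
theorem dist_lt_of_abs_snd_sub_lt (h : IsCircleChart P Q) {u x : M} {ρ η : ℝ} (hη : 0 < η)
    (hx : 0 < |P x|) (hsign : 0 < P u * P x) (hu : |Q u - Q x| < ρ) (hρ : ρ ≤ η * |P x| / 8) :
    dist u x < η := by
  have hρ0 : 0 < ρ := (abs_nonneg _).trans_lt hu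
  have hx1 := h.abs_fst_le x
  -- `|P u - P x| ≤ 2 * ρ / |P x|`, since `P ^ 2 = 1 - Q ^ 2`
  have h1 : |P u - P x| * |P x| ≤ 2 * ρ := by
    have h2 : |P x| ≤ |P u + P x| := by
      exact sq_le_sq.1 (by nlinarith [sq_nonneg (P u)])
    have h3 : |P u - P x| * |P u + P x| = |Q u - Q x| * |Q u + Q x| := by
      rw [← abs_mul, ← abs_mul, ← abs_neg]
      congr 1
      linarith [h.sq_add_sq u, h.sq_add_sq x]
    have h4 : |Q u + Q x| ≤ 2 := by
      linarith [abs_add_le (Q u) (Q x), h.abs_snd_le u, h.abs_snd_le x]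
    calc |P u - P x| * |P x| ≤ |P u - P x| * |P u + P x| :=
          mul_le_mul_of_nonneg_left h2 (abs_nonneg _)
      _ = |Q u - Q x| * |Q u + Q x| := h3
      _ ≤ ρ * 2 := mul_le_mul hu.le h4 (abs_nonneg _) hρ0.le
      _ = 2 * ρ := mul_comm _ _
  have h5 : |P u - P x| ≤ η / 4 := by
    refine le_of_mul_le_mul_right (h1.trans ?_) hx
    linarith
  have h6 : |Q u - Q x| ≤ η / 8 := by
    refine hu.le.trans (hρ.trans ?_)
    nlinarith
  refine lt_of_pow_lt_pow_left₀ 2 hη.le ?_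
  rw [h.dist_sq, ← sq_abs (P u - P x), ← sq_abs (Q u - Q x)]
  nlinarith [abs_nonneg (P u - P x), abs_nonneg (Q u - Q x)]

/-- A chord with both ends on the same side of the axis `P = 0` is not nearly parallel to the
`P`-direction. -/
theorem sq_sub_mul_le_of_same_side (h : IsCircleChart P Q) {u v : M} {t : ℝ}
    (hside : 0 ≤ P u * P v) (hu : t ^ 2 / 2 ≤ P u ^ 2) (hv : t ^ 2 / 2 ≤ P v ^ 2) :
    (P u - P v) ^ 2 * (1 + t ^ 2 / 4) ≤ dist u v ^ 2 := by
  have h1 : t ^ 2 ≤ (P u + P v) ^ 2 := by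
    have : (P u + P v) ^ 2 = P u ^ 2 + 2 * (P u * P v) + P v ^ 2 := by ring
    linarith
  have h2 : (P u - P v) ^ 2 * (P u + P v) ^ 2 = (Q u - Q v) ^ 2 * (Q u + Q v) ^ 2 := by
    have h3 : (P u - P v) * (P u + P v) = -((Q u - Q v) * (Q u + Q v)) := by
      linarith [h.sq_add_sq u, h.sq_add_sq v]
    rw [← mul_pow, h3, neg_sq, mul_pow]
  have h3 : (Q u + Q v) ^ 2 ≤ 2 ^ 2 := by
    rw [sq_le_sq, abs_of_pos (two_pos : (0 : ℝ) < 2)]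
    linarith [abs_add_le (Q u) (Q v), h.abs_snd_le u, h.abs_snd_le v]
  have h5 := mul_le_mul_of_nonneg_left h1 (sq_nonneg (P u - P v))
  have h6 := mul_le_mul_of_nonneg_left h3 (sq_nonneg (Q u - Q v))
  rw [h.dist_sq]
  linarith

theorem one_le_sq_one_sub_mul {t ρ : ℝ} (ht : t ≤ 1) (ht0 : 0 ≤ t) (hρ : ρ ≤ t ^ 2 / 16) :
    1 ≤ (1 - ρ) ^ 2 * (1 + t ^ 2 / 4) := by
  have h1 : 1 - t ^ 2 / 8 ≤ (1 - ρ) ^ 2 := by linarith [sq_nonneg ρ]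
  have h2 : t ^ 2 ≤ 1 := pow_le_one₀ ht0 ht
  have h3 := mul_le_mul_of_nonneg_right h1 (show 0 ≤ 1 + t ^ 2 / 4 by positivity)
  have h4 : t ^ 2 * t ^ 2 ≤ t ^ 2 * 1 := mul_le_mul_of_nonneg_left h2 (sq_nonneg t)
  linarith [sq_nonneg t]

/-- The damped coordinate grows at nearly full speed only along chords close to that from `y` to
`x`: such a chord has both ends near the line `Q = Q x`, by `sq_damped_sub_le`, and it is nearly
parallel to this line, so its ends are on opposite sides of the axis `P = 0`. -/
theorem damped_peaks (h : IsCircleChart P Q) {x y : M} (hQ : Q x = Q y) (hx : 0 < P x)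
    (hxy : P y = -P x) {η : ℝ} (hη : 0 < η) : ∃ κ > 0, ∀ u v : M, u ≠ v →
      (1 - κ) * dist u v < damped P Q (Q x) u - damped P Q (Q x) v →
      dist u x < η ∧ dist v y < η := by
  set t := P x with ht
  have ht1 : t ≤ 1 := (le_abs_self _).trans (h.abs_fst_le x)
  set ρ := min (t ^ 2 / 16) (η * t / 8) with hρ
  have hρ0 : 0 < ρ := by positivity
  have hρt : ρ ≤ t ^ 2 / 16 := min_le_left _ _
  have hρη : ρ ≤ η * t / 8 := min_le_right _ _
  have hρ1 : ρ ≤ 1 / 16 := by nlinarith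
  refine ⟨ρ ^ 2 / 32, by positivity, fun u v huv hlt => ?_⟩
  have hd := dist_pos.2 huv
  have hS : (Q u - Q x) ^ 2 + (Q v - Q x) ^ 2 < ρ ^ 2 := by
    have h1 := h.sq_damped_sub_le (h.abs_snd_le x) u v
    have h2 : ((1 - ρ ^ 2 / 32) * dist u v) ^ 2 <
        (damped P Q (Q x) u - damped P Q (Q x) v) ^ 2 :=
      pow_lt_pow_left₀ hlt (mul_nonneg (by nlinarith) hd.le) two_ne_zero
    have h3 : dist u v ^ 2 * (1 - ρ ^ 2 / 32) ^ 2 <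
        dist u v ^ 2 * (1 - ((Q u - Q x) ^ 2 + (Q v - Q x) ^ 2) / 16) := by
      rw [← mul_pow, mul_comm (dist u v)]
      exact h2.trans_le h1
    have h4 := lt_of_mul_lt_mul_left h3 (sq_nonneg _)
    linarith [sq_nonneg (ρ ^ 2)]
  have hu : |Q u - Q x| < ρ := abs_lt_of_sq_lt_sq (by linarith [sq_nonneg (Q v - Q x)]) hρ0.le
  have hv : |Q v - Q x| < ρ := abs_lt_of_sq_lt_sq (by linarith [sq_nonneg (Q u - Q x)]) hρ0.le
  have hPlow : ∀ w, |Q w - Q x| < ρ → t ^ 2 / 2 < P w ^ 2 := fun w hw => by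
    have h1 : |Q w - Q x| * |Q w + Q x| ≤ ρ * 2 := by
      refine mul_le_mul hw.le ?_ (abs_nonneg _) hρ0.le
      linarith [abs_add_le (Q w) (Q x), h.abs_snd_le w, h.abs_snd_le x]
    rw [← abs_mul] at h1
    have h2 := (le_abs_self _).trans h1
    linarith [h.sq_add_sq w, h.sq_add_sq x]
  have hdsq := h.dist_sq u v
  -- the increment is almost at most the increment of `P`
  have hinc : (1 - ρ) * dist u v < (P u - P v) * (1 - ((Q u - Q x) ^ 2 + (Q v - Q x) ^ 2) / 16) := by
    rw [damped_sub] at hlt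
    have hB : |Q u - Q v| ≤ dist u v :=
      abs_le_of_sq_le_sq (by linarith [sq_nonneg (P u - P v)]) hd.le
    have hr : |-((P u + P v) * (Q u - Q x + (Q v - Q x))) / 16| ≤ ρ / 4 := by
      rw [abs_div, abs_neg, abs_mul, abs_of_pos (show (0 : ℝ) < 16 by norm_num)]
      have h1 : |P u + P v| ≤ 2 := by
        linarith [abs_add_le (P u) (P v), h.abs_fst_le u, h.abs_fst_le v]
      have h2 : |Q u - Q x + (Q v - Q x)| ≤ 2 * ρ := by
        linarith [abs_add_le (Q u - Q x) (Q v - Q x)]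
      have h3 := mul_le_mul h1 h2 (abs_nonneg _) (by norm_num)
      linarith
    have h4 := mul_le_mul hB hr (abs_nonneg _) hd.le
    rw [← abs_mul] at h4
    have h5 := (le_abs_self _).trans h4
    have h6 : (1 - ρ) * dist u v ≤ (1 - ρ ^ 2 / 32 - ρ / 4) * dist u v :=
      mul_le_mul_of_nonneg_right (by nlinarith) hd.le
    linarith
  have hA : 0 < P u - P v := by
    by_contra hA
    have h1 : (P u - P v) * (1 - ((Q u - Q x) ^ 2 + (Q v - Q x) ^ 2) / 16) ≤ 0 :=
      mul_nonpos_of_nonpos_of_nonneg (not_lt.1 hA) (by nlinarith)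
    have h2 : 0 < (1 - ρ) * dist u v := mul_pos (by linarith) hd
    linarith
  have hA2 : (1 - ρ) * dist u v < P u - P v := by
    refine hinc.trans_le (mul_le_of_le_one_right hA.le ?_)
    linarith [sq_nonneg (Q u - Q x), sq_nonneg (Q v - Q x)]
  -- a chord with both ends on the same side of the axis is too steep
  have hopp : P u * P v < 0 := by
    by_contra hcon
    have h6 := h.sq_sub_mul_le_of_same_side (not_lt.1 hcon) (hPlow u hu).le (hPlow v hv).le
    have h5 : ((1 - ρ) * dist u v) ^ 2 < (P u - P v) ^ 2 :=
      pow_lt_pow_left₀ hA2 (mul_nonneg (by linarith) hd.le) two_ne_zero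
    have h7 := one_le_sq_one_sub_mul ht1 hx.le hρt
    have h8 : (1 - ρ) ^ 2 * ((P u - P v) ^ 2 * (1 + t ^ 2 / 4)) ≤ (1 - ρ) ^ 2 * dist u v ^ 2 :=
      mul_le_mul_of_nonneg_left h6 (sq_nonneg _)
    have h9 := mul_le_mul_of_nonneg_left h7 (sq_nonneg (P u - P v))
    rw [mul_pow] at h5
    linarith
  obtain ⟨hPu, hPv⟩ : 0 < P u ∧ P v < 0 := by
    rcases mul_neg_iff.1 hopp with h1 | h1
    · exact h1
    · linarith [h1.1, h1.2]
  refine ⟨h.dist_lt_of_abs_snd_sub_lt hη (abs_pos.2 hx.ne') (mul_pos hPu hx) hu ?_,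
    h.dist_lt_of_abs_snd_sub_lt (ρ := ρ) hη ?_ ?_ ?_ ?_⟩
  · rwa [abs_of_pos hx]
  · rw [hxy, abs_neg]
    exact abs_pos.2 hx.ne'
  · rw [hxy]
    exact mul_pos_of_neg_of_neg hPv (neg_neg_of_pos hx)
  · rwa [← hQ]
  · rwa [hxy, abs_neg, abs_of_pos hx]

theorem molecule_mem_stronglyExposedPoints (h : IsCircleChart P Q) {o x y : M} (hQ : Q x = Q y)
    (hx : 0 < P x) (hxy : P y = -P x) {X : Type*} [NormedAddCommGroup X] [NormedSpace ℝ X]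
    {δ : M → X} (hδ : IsLipschitzFree o δ) :
    molecule δ x y ∈ stronglyExposedPoints (Metric.closedBall (0 : X) 1) := by
  let f : LipZero o := ⟨fun u => damped P Q (Q x) u - damped P Q (Q x) o, sub_self _, 1,
    LipschitzWith.of_dist_le_mul fun u v => by
      rw [Real.dist_eq, sub_sub_sub_cancel_right, NNReal.coe_one, one_mul]
      exact h.abs_damped_sub_le (h.abs_snd_le x) u v⟩
  have hf : ∀ u v, f u - f v = damped P Q (Q x) u - damped P Q (Q x) v := fun u v =>
    sub_sub_sub_cancel_right _ _ _
  have hne : x ≠ y := by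
    rintro rfl
    linarith
  refine hδ.molecule_mem_stronglyExposedPoints (f := f) ?_ hne ?_ fun η hη => ?_
  · refine LipZero.norm_le_of_forall _ zero_le_one fun u v => ?_
    rw [hf, one_mul]
    exact h.abs_damped_sub_le (h.abs_snd_le x) u v
  · have h1 := h.dist_sq x y
    rw [hxy, ← hQ, sub_self, zero_pow two_ne_zero, add_zero, sub_neg_eq_add] at h1
    rw [hf, damped_sub, hxy, ← hQ, (pow_left_inj₀ dist_nonneg (by linarith) two_ne_zero).1 h1]
    ring
  · obtain ⟨κ, hκ, hp⟩ := h.damped_peaks hQ hx hxy hη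
    exact ⟨κ, hκ, fun u v huv hlt => hp u v huv (by rwa [hf] at hlt)⟩

end IsCircleChart

/-- The Euclidean unit circle. -/
local notation "𝕋" => Metric.sphere (0 : EuclideanSpace ℝ (Fin 2)) 1

theorem isCircleChart_coord : IsCircleChart (fun u : 𝕋 => u.1 0) (fun u : 𝕋 => u.1 1) where
  sq_add_sq u := by
    have h := norm_eq_of_mem_sphere u
    rw [EuclideanSpace.norm_eq, Real.sqrt_eq_one, Fin.sum_univ_two] at h
    simpa using h
  dist_sq u v := by
    rw [Subtype.dist_eq, EuclideanSpace.dist_eq, Real.sq_sqrt (by positivity), Fin.sum_univ_two,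
      Real.dist_eq, Real.dist_eq, sq_abs, sq_abs]

theorem IsCircleChart.rotate {M : Type*} [MetricSpace M] {P Q : M → ℝ} (h : IsCircleChart P Q)
    {a b : ℝ} (hab : a ^ 2 + b ^ 2 = 1) :
    IsCircleChart (fun u => a * P u + b * Q u) (fun u => a * Q u - b * P u) where
  sq_add_sq u := by
    linear_combination (P u ^ 2 + Q u ^ 2) * hab + h.sq_add_sq u
  dist_sq u v := by
    rw [h.dist_sq]
    linear_combination (-((P u - P v) ^ 2 + (Q u - Q v) ^ 2)) * hab

/-- Coordinates in which the chord from `y` to `x` is parallel to the `P`-axis. -/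
theorem IsCircleChart.exists_horizontal {M : Type*} [MetricSpace M] {P Q : M → ℝ}
    (h : IsCircleChart P Q) {x y : M} (hxy : x ≠ y) :
    ∃ P' Q' : M → ℝ, IsCircleChart P' Q' ∧ Q' x = Q' y ∧ 0 < P' x ∧ P' y = -P' x := by
  have hd := dist_pos.2 hxy
  have hab : ((P x - P y) / dist x y) ^ 2 + ((Q x - Q y) / dist x y) ^ 2 = 1 := by
    rw [div_pow, div_pow, ← add_div, ← h.dist_sq, div_self (by positivity)]
  have h1 := h.sq_add_sq x
  have h2 := h.sq_add_sq y
  refine ⟨_, _, h.rotate hab, ?_, ?_, ?_⟩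
  · field_simp
    ring
  · have h3 : 0 < (P x - P y) * P x + (Q x - Q y) * Q x := by
      nlinarith [h.dist_sq x y, sq_pos_of_pos hd]
    have h4 : (P x - P y) / dist x y * P x + (Q x - Q y) / dist x y * Q x =
      ((P x - P y) * P x + (Q x - Q y) * Q x) / dist x y := by ring
    rw [h4]
    exact div_pos h3 hd
  · field_simp
    linarith

theorem IsLipschitzFree.closedBall_eq_of_circleChart {M : Type*} [MetricSpace M] [Nontrivial M]
    {P Q : M → ℝ} (hPQ : IsCircleChart P Q) {o : M} {X : Type*} [NormedAddCommGroup X]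
    [NormedSpace ℝ X] {δ : M → X} (hδ : IsLipschitzFree o δ) :
    Metric.closedBall (0 : X) 1 =
      closure (convexHull ℝ (stronglyExposedPoints (Metric.closedBall (0 : X) 1))) := by
  refine Set.Subset.antisymm ?_ ?_
  · refine hδ.closedBall_subset_closure_convexHull.trans (closure_mono (convexHull_mono ?_))
    rintro _ ⟨x, y, hxy, rfl⟩
    obtain ⟨P', Q', h, hQ, hx, hPy⟩ := hPQ.exists_horizontal hxy
    exact h.molecule_mem_stronglyExposedPoints hQ hx hPy hδ
  · exact closure_minimal (convexHull_min (fun μ hμ => hμ.1) (convex_closedBall _ _))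
      Metric.isClosed_closedBall

theorem closedBall_lipschitzFree_circle (o : 𝕋) :
    Metric.closedBall (0 : LipschitzFree o) 1 =
      closure (convexHull ℝ
        (stronglyExposedPoints (Metric.closedBall (0 : LipschitzFree o) 1))) := by
  have : Nontrivial 𝕋 := by
    obtain ⟨x, hx⟩ := (NormedSpace.sphere_nonempty (x := (0 : EuclideanSpace ℝ (Fin 2)))
      (r := 1)).2 zero_le_one
    exact ⟨⟨x, hx⟩, -⟨x, hx⟩, ne_neg_of_mem_unit_sphere ℝ ⟨x, hx⟩⟩
  exact (isLipschitzFree_delta o).closedBall_eq_of_circleChart isCircleChart_coord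

/-! ### A function with many gaps -/

open MeasureTheory in
/-- There is a function that increases from `0` on `[0, 1/64]`, with average slope at least `1/2`,
although every short interval of length `w` contains an interval of length at least `w ^ 2 / 4` on
which it is constant. It is the distribution function of a fat Cantor set. -/
theorem exists_gap_function : ∃ G : ℝ → ℝ,
    (∀ s t, |G s - G t| ≤ |s - t|) ∧ (∀ t, 0 ≤ G t) ∧ (∀ t, G t ≤ 1 / 64) ∧
    (∀ t ≤ 0, G t = 0) ∧ (∀ t ≥ 1 / 64, G t = G (1 / 64)) ∧ 1 / 128 ≤ G (1 / 64) ∧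
    ∀ s t, s < t → t - s < 6 / 64 →
      ∃ a b, s ≤ a ∧ a ≤ b ∧ b ≤ t ∧ (t - s) ^ 2 / 4 ≤ b - a ∧ G a = G b := by
  let h : ℕ → ℝ := fun n => 1 / 64 / 2 ^ n
  have h0 : ∀ n, 0 < h n := fun n => by positivity
  have hle : ∀ n, h n ≤ 1 / 64 := fun n =>
    div_le_self (by norm_num) (one_le_pow₀ (by norm_num))
  have hsucc : ∀ n, h n = 2 * h (n + 1) := fun n => by
    simp only [h, pow_succ]
    field_simp
  have hpow : ∀ n, (2 ^ n : ℝ) * h n = 1 / 64 := fun n => by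
    simp only [h]
    field_simp
  -- the gaps of level `n` have length `16 * h n ^ 2`: at least `w ^ 2 / 4` for `w < 6 * h n`, while
  -- the gaps of all levels have total length at most half of `1 / 64`
  let E : ℕ → Set ℝ := fun n => ⋃ k ∈ Finset.range (2 ^ n),
    Set.Ico ((k : ℝ) * h n) (k * h n + 16 * h n ^ 2)
  let A : Set ℝ := Set.Ico 0 (1 / 64) \ ⋃ n, E n
  have hE : ∀ n, volume (E n) ≤ ENNReal.ofReal (1 / 256 * (1 / 2) ^ n) := fun n => by
    refine (measure_biUnion_finset_le _ _).trans ?_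
    simp only [Real.volume_Ico, add_sub_cancel_left, Finset.sum_const, Finset.card_range,
      nsmul_eq_mul]
    rw [← ENNReal.ofReal_natCast, ← ENNReal.ofReal_mul (by positivity)]
    refine ENNReal.ofReal_le_ofReal (le_of_eq ?_)
    simp only [h, Nat.cast_pow, Nat.cast_ofNat, one_div, inv_pow]
    field_simp
    norm_num
  have hEU : volume (⋃ n, E n) ≤ ENNReal.ofReal (1 / 128) := by
    refine (measure_iUnion_le _).trans ((ENNReal.tsum_le_tsum hE).trans ?_)
    rw [← ENNReal.ofReal_tsum_of_nonneg (fun n => by positivity)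
      (summable_geometric_two.mul_left _), tsum_mul_left, tsum_geometric_two]
    norm_num
  have hAfin : ∀ s : Set ℝ, volume (A ∩ s) ≠ ⊤ := fun s =>
    measure_ne_top_of_subset (Set.inter_subset_left.trans Set.sdiff_subset)
      (by rw [Real.volume_Ico]; exact ENNReal.ofReal_ne_top)
  have hAm : MeasurableSet A := measurableSet_Ico.diff <| MeasurableSet.iUnion fun n =>
    Finset.measurableSet_biUnion _ fun _ _ => measurableSet_Ico
  let G : ℝ → ℝ := fun t => volume.real (A ∩ Set.Iio t)
  have hG : ∀ a b, a ≤ b → G b = G a + volume.real (A ∩ Set.Ico a b) := fun a b hab => by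
    simp only [G]
    rw [← Set.Iio_union_Ico_eq_Iio hab, Set.inter_union_distrib_left]
    refine measureReal_union ?_ (hAm.inter measurableSet_Ico) (hAfin _) (hAfin _)
    refine Set.disjoint_left.2 fun x hx hx' => ?_
    exact (not_lt.2 hx'.2.1) hx.2
  have hempty : ∀ a b, a ≤ b → A ∩ Set.Ico a b = ∅ → G a = G b := fun a b hab hemp => by
    rw [hG a b hab, hemp, measureReal_empty, add_zero]
  have hlip : ∀ a b, a ≤ b → |G a - G b| ≤ |a - b| := fun a b hab => by
    have h1 : volume.real (A ∩ Set.Ico a b) ≤ b - a := by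
      refine (measureReal_mono Set.inter_subset_right ?_).trans ?_
      · rw [Real.volume_Ico]; exact ENNReal.ofReal_ne_top
      · rw [Real.volume_real_Ico_of_le hab]
    rw [hG a b hab, sub_add_cancel_left, abs_neg, abs_of_nonneg measureReal_nonneg, abs_sub_comm,
      abs_of_nonneg (sub_nonneg.2 hab)]
    exact h1
  have hzero : ∀ t ≤ 0, G t = 0 := fun t ht => by
    have : A ∩ Set.Iio t = ∅ := by
      refine Set.eq_empty_of_forall_notMem fun x hx => ?_
      exact (not_lt.2 (ht.trans hx.1.1.1)) hx.2
    simp only [G, this, measureReal_empty]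
  have hconst : ∀ t ≥ 1 / 64, G t = G (1 / 64) := fun t ht => by
    refine (hempty _ _ ht (Set.eq_empty_of_forall_notMem fun x hx => ?_)).symm
    exact (not_lt.2 hx.2.1) hx.1.1.2
  have hnonneg : ∀ t, 0 ≤ G t := fun t => measureReal_nonneg
  refine ⟨G, fun s t => ?_, hnonneg, fun t => ?_, hzero, hconst, ?_, fun s t hst hw => ?_⟩
  · rcases le_total s t with hst | hst
    · exact hlip s t hst
    · rw [abs_sub_comm, abs_sub_comm s]
      exact hlip t s hst
  · refine (measureReal_mono (Set.inter_subset_left.trans Set.sdiff_subset)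
      (by rw [Real.volume_Ico]; exact ENNReal.ofReal_ne_top)).trans ?_
    rw [Real.volume_real_Ico_of_le (by norm_num), sub_zero]
  · have h1 : volume (Set.Ico (0 : ℝ) (1 / 64)) ≤
        volume (A ∩ Set.Iio (1 / 64)) + ENNReal.ofReal (1 / 128) := by
      refine le_trans ?_ (add_le_add le_rfl hEU)
      refine (measure_mono fun x hx => ?_).trans (measure_union_le _ _)
      by_cases hxE : x ∈ ⋃ n, E n
      · exact Or.inr hxE
      · exact Or.inl ⟨⟨hx, hxE⟩, hx.2⟩
    have h2 := ENNReal.toReal_mono (ENNReal.add_ne_top.2 ⟨hAfin _, ENNReal.ofReal_ne_top⟩) h1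
    rw [ENNReal.toReal_add (hAfin _) ENNReal.ofReal_ne_top, Real.volume_Ico,
      ENNReal.toReal_ofReal (by norm_num), ENNReal.toReal_ofReal (by norm_num)] at h2
    change 1 / 128 ≤ (volume (A ∩ Set.Iio (1 / 64))).toReal
    linarith
  · have hex : ∃ n, 2 * h n ≤ t - s := by
      have hlim : Tendsto (fun n => 2 * h n) atTop (𝓝 0) := by
        have := (tendsto_pow_atTop_nhds_zero_of_lt_one (r := (1 / 2 : ℝ)) (by norm_num)
          (by norm_num)).const_mul (2 * (1 / 64))
        rw [mul_zero] at this
        refine this.congr fun n => ?_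
        simp only [h, one_div, inv_pow]
        ring
      exact ((hlim.eventually_lt_const (sub_pos.2 hst)).exists).imp fun _ => le_of_lt
    -- the first level whose grid has two points in `[s, t]`
    obtain ⟨n, hn, hmin⟩ : ∃ n, 2 * h n ≤ t - s ∧ t - s < 6 * h n := by
      classical
      refine ⟨Nat.find hex, Nat.find_spec hex, ?_⟩
      rcases hm : Nat.find hex with _ | m
      · simp only [h, pow_zero, div_one]
        linarith
      · have h1 := Nat.find_min hex (m := m) (by omega)
        have h2 := h0 (m + 1)
        rw [hsucc] at h1
        linarith
    set k : ℤ := ⌈s / h n⌉ with hk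
    have hk1 : s ≤ k * h n := (div_le_iff₀ (h0 n)).1 (Int.le_ceil _)
    have hk2 : k * h n < s + h n := by
      have := Int.ceil_lt_add_one (s / h n)
      rw [← hk, ← sub_lt_iff_lt_add, lt_div_iff₀ (h0 n)] at this
      linarith
    have hg : 16 * h n ^ 2 ≤ h n := by nlinarith [hle n, h0 n]
    refine ⟨k * h n, k * h n + 16 * h n ^ 2, hk1, by linarith [sq_nonneg (h n)], by linarith, ?_,
      hempty _ _ (by linarith [sq_nonneg (h n)]) (Set.eq_empty_of_forall_notMem ?_)⟩
    · have h1 : (t - s) ^ 2 ≤ (6 * h n) ^ 2 :=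
        pow_le_pow_left₀ (sub_nonneg.2 hst.le) hmin.le 2
      rw [add_sub_cancel_left]
      nlinarith [sq_nonneg (h n)]
    · rintro x ⟨⟨⟨hx0, hx1⟩, hxE⟩, hxk, hxk'⟩
      have hk0 : 0 ≤ k := by
        have h1 : (0 : ℝ) < (k + 1 : ℝ) * h n := by linarith
        have h2 : (0 : ℝ) < (k + 1 : ℝ) := pos_of_mul_pos_left h1 (h0 n).le
        have h3 : 0 < k + 1 := by exact_mod_cast h2
        omega
      obtain ⟨j, hj⟩ := Int.eq_ofNat_of_zero_le hk0
      have hjk : (k : ℝ) = j := by rw [hj]; rfl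
      rw [hjk] at hxk hxk'
      have hj2 : j < 2 ^ n := by
        have h1 : (j : ℝ) * h n < 2 ^ n * h n := by rw [hpow]; linarith
        have h2 := lt_of_mul_lt_mul_right h1 (h0 n).le
        exact_mod_cast h2
      exact hxE (Set.mem_iUnion.2 ⟨n, Set.mem_biUnion (Finset.mem_coe.2 (Finset.mem_range.2 hj2))
        ⟨hxk, hxk'⟩⟩)

/-! ### Strong norm attainment on the circle -/

/-- The half circle given by the sign `σ` has a point at each height `a`. -/
theorem exists_circle_point {σ a : ℝ} (hσ : σ ^ 2 = 1) (ha : |a| ≤ 1) :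
    ∃ u : 𝕋, u.1 0 = σ * √(1 - a ^ 2) ∧ u.1 1 = a := by
  have h1 : 0 ≤ 1 - a ^ 2 := by
    have := (sq_le_one_iff_abs_le_one a).2 ha
    linarith
  refine ⟨⟨!₂[σ * √(1 - a ^ 2), a], ?_⟩, rfl, rfl⟩
  rw [mem_sphere_zero_iff_norm, EuclideanSpace.norm_eq, Real.sqrt_eq_one, Fin.sum_univ_two]
  simp only [Matrix.cons_val_zero, Matrix.cons_val_one, Real.norm_eq_abs, sq_abs]
  rw [mul_pow, hσ, Real.sq_sqrt h1]
  ring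

namespace IsCircleChart

variable {M : Type*} [MetricSpace M] {P Q : M → ℝ}

/-- On a half circle the distance is the chord of the difference of the angles `arcsin Q`. -/
theorem dist_eq_of_sign (h : IsCircleChart P Q) {σ : ℝ} (hσ : σ ^ 2 = 1) {u v : M}
    (hu : P u = σ * √(1 - Q u ^ 2)) (hv : P v = σ * √(1 - Q v ^ 2)) :
    dist u v = 2 * |Real.sin ((Real.arcsin (Q u) - Real.arcsin (Q v)) / 2)| := by
  refine (pow_left_inj₀ dist_nonneg (by positivity) two_ne_zero).1 ?_
  have hsu := Real.sin_arcsin (abs_le.1 (h.abs_snd_le u)).1 (abs_le.1 (h.abs_snd_le u)).2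
  have hsv := Real.sin_arcsin (abs_le.1 (h.abs_snd_le v)).1 (abs_le.1 (h.abs_snd_le v)).2
  rw [h.dist_sq, hu, hv, ← Real.cos_arcsin, ← Real.cos_arcsin, mul_pow, sq_abs]
  nth_rewrite 2 [← hsu, ← hsv]
  set x := Real.arcsin (Q u)
  set y := Real.arcsin (Q v)
  have h1 : Real.sin ((x - y) / 2) ^ 2 = 1 / 2 - Real.cos (x - y) / 2 := by
    rw [Real.sin_sq_eq_half_sub, mul_div_cancel₀ _ (two_ne_zero' ℝ)]
  rw [h1, Real.cos_sub]
  linear_combination (Real.cos x - Real.cos y) ^ 2 * hσ + Real.sin_sq_add_cos_sq x +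
    Real.sin_sq_add_cos_sq y

theorem dist_le_arcsin_sub (h : IsCircleChart P Q) {σ : ℝ} (hσ : σ ^ 2 = 1) {u v : M}
    (hu : P u = σ * √(1 - Q u ^ 2)) (hv : P v = σ * √(1 - Q v ^ 2)) (huv : Q u ≤ Q v) :
    dist u v ≤ Real.arcsin (Q v) - Real.arcsin (Q u) := by
  have h1 := Real.monotone_arcsin huv
  rw [dist_comm, h.dist_eq_of_sign hσ hv hu]
  have h2 := Real.abs_sin_le_abs (x := (Real.arcsin (Q v) - Real.arcsin (Q u)) / 2)
  rw [abs_of_nonneg (by linarith : 0 ≤ (Real.arcsin (Q v) - Real.arcsin (Q u)) / 2)] at h2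
  linarith

end IsCircleChart

theorem sub_le_arcsin_sub {a b : ℝ} (hab : a ≤ b) (ha : -1 ≤ a) (hb : b ≤ 1) :
    b - a ≤ Real.arcsin b - Real.arcsin a := by
  have h := Real.abs_sin_sub_sin_le (Real.arcsin b) (Real.arcsin a)
  rw [Real.sin_arcsin (ha.trans hab) hb, Real.sin_arcsin ha (hab.trans hb),
    abs_of_nonneg (sub_nonneg.2 hab),
    abs_of_nonneg (sub_nonneg.2 (Real.monotone_arcsin hab))] at h
  exact h

/-- On a short arc of the circle the chord is shorter than the angle by a cubic term only. The
term is expressed by the difference of the heights, of which the angle is at most twice. -/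
theorem IsCircleChart.arcsin_sub_sub_cube_lt_dist {M : Type*} [MetricSpace M] {P Q : M → ℝ}
    (h : IsCircleChart P Q) {σ : ℝ} (hσ : σ ^ 2 = 1) {u v : M}
    (hu : P u = σ * √(1 - Q u ^ 2)) (hv : P v = σ * √(1 - Q v ^ 2)) (huv : Q u < Q v)
    (hu8 : |Q u| ≤ 1 / 8) (hv8 : |Q v| ≤ 1 / 8) :
    Real.arcsin (Q v) - Real.arcsin (Q u) - (2 * (Q v - Q u)) ^ 3 / 24 < dist u v := by
  have hu1 := abs_le.1 hu8
  have hv1 := abs_le.1 hv8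
  set w := Q v - Q u with hw
  set s := Real.arcsin (Q v) - Real.arcsin (Q u) with hs
  have hw0 : 0 < w := sub_pos.2 huv
  have hs0 : 0 < s := hw0.trans_le (sub_le_arcsin_sub huv.le (by linarith) (by linarith))
  have hsπ : s / 2 ≤ Real.pi / 2 := by
    linarith [Real.arcsin_le_pi_div_two (Q v), Real.neg_pi_div_two_le_arcsin (Q u)]
  have hjordan := Real.mul_le_sin (half_pos hs0).le hsπ
  have hsin : 0 ≤ Real.sin (s / 2) := (by positivity : 0 ≤ 2 / Real.pi * (s / 2)).trans hjordan
  have hd : dist u v = 2 * Real.sin (s / 2) := by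
    rw [dist_comm, h.dist_eq_of_sign hσ hv hu, ← hs, abs_of_nonneg hsin]
  have hdw : dist u v ≤ 11 / 10 * w := by
    refine le_of_sq_le_sq ?_ (by positivity)
    have hroot : ∀ w, |Q w| ≤ 1 / 8 → 3 / 4 ≤ √(1 - Q w ^ 2) ∧ √(1 - Q w ^ 2) ^ 2 = 1 - Q w ^ 2 :=
      fun w hw => by
        have h1 : Q w ^ 2 ≤ (1 / 8) ^ 2 := sq_le_sq' (abs_le.1 hw).1 (abs_le.1 hw).2
        exact ⟨Real.le_sqrt_of_sq_le (by linarith), Real.sq_sqrt (by linarith)⟩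
    obtain ⟨hA, hA2⟩ := hroot u hu8
    obtain ⟨hB, hB2⟩ := hroot v hv8
    rw [h.dist_sq, hu, hv, ← mul_sub, mul_pow, hσ, one_mul]
    set A := √(1 - Q u ^ 2)
    set B := √(1 - Q v ^ 2)
    have h1 : |A - B| * (3 / 2) ≤ w * (1 / 4) := by
      have h2 : (A - B) * (A + B) = w * (Q u + Q v) := by
        rw [hw]
        linear_combination hA2 - hB2
      have h3 : |A - B| * (A + B) = w * |Q u + Q v| := by
        rw [← abs_of_nonneg (by linarith : 0 ≤ A + B), ← abs_mul, h2, abs_mul, abs_of_pos hw0]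
      have h4 : |Q u + Q v| ≤ 1 / 4 := by linarith [abs_add_le (Q u) (Q v)]
      calc |A - B| * (3 / 2) ≤ |A - B| * (A + B) :=
            mul_le_mul_of_nonneg_left (by linarith) (abs_nonneg _)
        _ = w * |Q u + Q v| := h3
        _ ≤ w * (1 / 4) := mul_le_mul_of_nonneg_left h4 hw0.le
    have h5 : (A - B) ^ 2 ≤ (w / 6) ^ 2 := sq_le_sq.2 (by
      rw [abs_of_pos (by positivity : 0 < w / 6)]
      linarith)
    have h6 : (Q u - Q v) ^ 2 = w ^ 2 := by rw [hw]; ring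
    rw [h6]
    linarith [sq_nonneg w]
  have hsw : s ≤ 2 * w := by
    rw [hd] at hdw
    have h1 : 2 / Real.pi * (s / 2) = s / Real.pi := by ring
    rw [h1] at hjordan
    have h2 : s / Real.pi ≤ 11 / 20 * w := by linarith
    rw [div_le_iff₀ Real.pi_pos] at h2
    have h3 : w * Real.pi ≤ w * 3.15 := mul_le_mul_of_nonneg_left Real.pi_lt_d2.le hw0.le
    linarith
  have hcube := Real.sin_gt_sub_cube (half_pos hs0)
  have h3 : s ^ 3 ≤ (2 * w) ^ 3 := pow_le_pow_left₀ hs0.le hsw 3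
  rw [hd]
  linarith

/-- There is a ball of Lipschitz functions on the circle none of which attains its norm. Its centre
is the function `G` of `exists_gap_function`, applied to the height. If `g` attains its norm at
`p, q`, then these points are close together, because `G` oscillates little. The gap of `G` between
their heights costs `g` a growth of order `w ^ 2` on the arc from `p` to `q`, where `w` is the
difference of the heights, but the arc exceeds the chord by a term of order `w ^ 3` only. -/
theorem exists_forall_near_notMem_SNA (o : 𝕋) :
    ∃ f : LipZero o, ∀ g : LipZero o, ‖g - f‖ ≤ 1 / 32 → g ∉ LipZero.SNA o := by
  obtain ⟨G, hlip, hG0, hG1, hGneg, hGpos, hGbig, hgap⟩ := exists_gap_function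
  have hc := isCircleChart_coord
  set P : 𝕋 → ℝ := fun u => u.1 0 with hP
  set Q : 𝕋 → ℝ := fun u => u.1 1 with hQ
  have hpoint : ∀ σ a : ℝ, σ ^ 2 = 1 → |a| ≤ 1 → ∃ u, P u = σ * √(1 - a ^ 2) ∧ Q u = a :=
    fun σ a hσ ha => exists_circle_point hσ ha
  clear_value P Q
  have hQd : ∀ u v, |Q u - Q v| ≤ dist u v := fun u v =>
    abs_le_of_sq_le_sq (by linarith [hc.dist_sq u v, sq_nonneg (P u - P v)]) dist_nonneg
  have hPd : ∀ u v, |P u - P v| ≤ dist u v := fun u v =>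
    abs_le_of_sq_le_sq (by linarith [hc.dist_sq u v, sq_nonneg (Q u - Q v)]) dist_nonneg
  let f : LipZero o := ⟨fun u => G (Q u) - G (Q o), sub_self _, 1,
    LipschitzWith.of_dist_le_mul fun u v => by
      rw [Real.dist_eq, sub_sub_sub_cancel_right, NNReal.coe_one, one_mul]
      exact (hlip _ _).trans (hQd u v)⟩
  have hf : ∀ u v, f u - f v = G (Q u) - G (Q v) := fun u v => sub_sub_sub_cancel_right _ _ _
  have hfnorm : 1 / 4 ≤ ‖f‖ := by
    obtain ⟨u, hu1, hu2⟩ := hpoint 1 (1 / 64) (by norm_num) (by norm_num [abs_of_pos])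
    obtain ⟨v, hv1, hv2⟩ := hpoint 1 0 (by norm_num) (by norm_num)
    have h1 := f.abs_sub_le u v
    rw [hf, hu2, hv2, hGneg 0 le_rfl, sub_zero, abs_of_nonneg (hG0 _)] at h1
    have h2 : dist u v ≤ 1 / 32 := by
      refine le_of_sq_le_sq ?_ (by norm_num)
      rw [hc.dist_sq, hu1, hu2, hv1, hv2]
      have h3 : 63 / 64 ≤ √(1 - (1 / 64 : ℝ) ^ 2) := Real.le_sqrt_of_sq_le (by norm_num)
      have h4 : √(1 - (1 / 64 : ℝ) ^ 2) ≤ 1 := Real.sqrt_le_one.2 (by norm_num)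
      have h5 : √(1 - (0 : ℝ) ^ 2) = 1 := by norm_num
      rw [h5]
      nlinarith
    have h3 := mul_le_mul_of_nonneg_left h2 (norm_nonneg f)
    linarith
  refine ⟨f, fun g hg hsna => ?_⟩
  have hgf : ∀ u v, |g u - g v| ≤ |G (Q u) - G (Q v)| + 1 / 32 * dist u v := fun u v => by
    have h1 := (g - f).abs_sub_le u v
    have h2 : g u - g v = (f u - f v) + ((g - f) u - (g - f) v) := by
      have h3 : ∀ x, g x = (g - f) x + f x := fun x => by
        rw [← LipZero.add_apply, sub_add_cancel]
      rw [h3 u, h3 v]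
      ring
    rw [h2, hf]
    exact (abs_add_le _ _).trans (add_le_add le_rfl
      (h1.trans (mul_le_mul_of_nonneg_right hg dist_nonneg)))
  have hgnorm : 7 / 32 ≤ ‖g‖ := by
    have := norm_sub_norm_le f g
    rw [norm_sub_rev] at this
    linarith
  have key : ∀ p q, Q p < Q q → ‖g‖ * dist p q = |g p - g q| → False := by
    intro p q hpq hatt
    have hd0 : 0 < dist p q := dist_pos.2 (by rintro rfl; exact hpq.false)
    have h1 := hgf p q
    rw [← hatt] at h1
    have h2 : 6 / 32 * dist p q ≤ |G (Q p) - G (Q q)| := by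
      linarith [mul_le_mul_of_nonneg_right hgnorm hd0.le]
    have hd : dist p q ≤ 1 / 12 := by
      have h3 : |G (Q p) - G (Q q)| ≤ 1 / 64 :=
        abs_le.2 ⟨by linarith [hG0 (Q p), hG1 (Q q)], by linarith [hG0 (Q q), hG1 (Q p)]⟩
      linarith
    have hne : G (Q p) ≠ G (Q q) := fun he => by
      rw [he, sub_self, abs_zero] at h2
      linarith
    have hp64 : Q p < 1 / 64 := by
      by_contra hcon
      have h3 := not_lt.1 hcon
      exact hne ((hGpos _ h3).trans (hGpos _ (h3.trans hpq.le)).symm)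
    have hq0 : 0 < Q q := by
      by_contra hcon
      have h3 := not_lt.1 hcon
      exact hne ((hGneg _ (hpq.le.trans h3)).trans (hGneg _ h3).symm)
    have hw := abs_le.1 ((hQd p q).trans hd)
    have hp8 : |Q p| ≤ 1 / 8 := abs_le.2 ⟨by linarith, by linarith⟩
    have hq8 : |Q q| ≤ 1 / 8 := abs_le.2 ⟨by linarith, by linarith⟩
    -- both points lie on the same half circle
    obtain ⟨σ, hσ, hpσ, hqσ⟩ : ∃ σ : ℝ, σ ^ 2 = 1 ∧ P p = σ * √(1 - Q p ^ 2) ∧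
        P q = σ * √(1 - Q q ^ 2) := by
      have hroot : ∀ u, √(1 - Q u ^ 2) = |P u| := fun u => by
        rw [← Real.sqrt_sq_eq_abs]
        congr 1
        linarith [hc.sq_add_sq u]
      rw [hroot, hroot]
      have hbig : 3 / 4 ≤ |P p| := by
        rw [← hroot]
        refine Real.le_sqrt_of_sq_le ?_
        have := sq_le_sq' (abs_le.1 hp8).1 (abs_le.1 hp8).2
        linarith
      have hPpq := abs_le.1 ((hPd p q).trans hd)
      rcases le_total 0 (P p) with h3 | h3
      · rw [abs_of_nonneg h3] at hbig
        exact ⟨1, by norm_num, by rw [abs_of_nonneg h3, one_mul],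
          by rw [abs_of_nonneg (by linarith), one_mul]⟩
      · rw [abs_of_nonpos h3] at hbig
        exact ⟨-1, by norm_num, by rw [abs_of_nonpos h3, neg_one_mul, neg_neg],
          by rw [abs_of_nonpos (by linarith), neg_one_mul, neg_neg]⟩
    obtain ⟨a, b, hpa, hab, hbq, hlen, hGab⟩ := hgap (Q p) (Q q) hpq (by linarith)
    have hp1 := abs_le.1 hp8
    have hq1 := abs_le.1 hq8
    obtain ⟨u, hu, rfl⟩ := hpoint σ a hσ (abs_le.2 ⟨by linarith, by linarith⟩)
    obtain ⟨v, hv, rfl⟩ := hpoint σ b hσ (abs_le.2 ⟨by linarith, by linarith⟩)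
    have d1 := hc.dist_le_arcsin_sub hσ hpσ hu hpa
    have d2 := hc.dist_le_arcsin_sub hσ hu hv hab
    have d3 := hc.dist_le_arcsin_sub hσ hv hqσ hbq
    have d4 := hc.arcsin_sub_sub_cube_lt_dist hσ hpσ hqσ hpq hp8 hq8
    have d5 := sub_le_arcsin_sub hab (by linarith) (by linarith)
    -- the function grows at most half as fast as possible on the gap from `u` to `v`
    have huv : |g u - g v| ≤ ‖g‖ * (dist u v / 2) := by
      have h3 := hgf u v
      rw [hGab, sub_self, abs_zero, zero_add] at h3
      have h4 := mul_le_mul_of_nonneg_right hgnorm (dist_nonneg (x := u) (y := v))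
      have h5 := dist_nonneg (x := u) (y := v)
      linarith
    have hchain : dist p q ≤ dist p u + dist u v / 2 + dist v q := by
      refine le_of_mul_le_mul_left (a := ‖g‖) ?_ (by linarith)
      have h3 := abs_sub_le (g p) (g u) (g q)
      have h4 := abs_sub_le (g u) (g v) (g q)
      linarith [g.abs_sub_le p u, g.abs_sub_le v q]
    have hw0 : 0 < Q q - Q p := sub_pos.2 hpq
    have hcube : (Q q - Q p) ^ 3 ≤ (Q q - Q p) ^ 2 * (1 / 12) := by
      rw [pow_succ]
      exact mul_le_mul_of_nonneg_left (by linarith) (sq_nonneg _)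
    have hsq : 0 < (Q q - Q p) ^ 2 := by positivity
    have hexp : (2 * (Q q - Q p)) ^ 3 = 8 * (Q q - Q p) ^ 3 := by ring
    rw [hexp] at d4
    linarith
  obtain ⟨p, q, hpq, hatt⟩ := hsna
  rw [eq_div_iff (dist_pos.2 hpq).ne'] at hatt
  rcases lt_trichotomy (Q p) (Q q) with h1 | h1 | h1
  · exact key p q h1 hatt
  · have h2 := hgf p q
    rw [← hatt, h1, sub_self, abs_zero, zero_add] at h2
    have h3 := le_of_mul_le_mul_right h2 (dist_pos.2 hpq)
    linarith
  · exact key q p h1 (by rw [dist_comm, hatt, abs_sub_comm])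

theorem not_propertyA_lipschitzFree_circle (o : 𝕋) : ¬ PropertyA (LipschitzFree o) := by
  intro hA
  have hdense := (isLipschitzFree_delta o).dense_SNA_of_propertyA hA
  obtain ⟨f, hf⟩ := exists_forall_near_notMem_SNA o
  obtain ⟨g, hg, hlt⟩ := Metric.mem_closure_iff.1 (hdense f) (1 / 32) (by norm_num)
  rw [dist_comm, dist_eq_norm] at hlt
  exact hf g hlt.le hg

/-! ### Property A and Lipschitz-free spaces -/

theorem mainTheorem3 :
    (∀ o : Metric.sphere (0 : EuclideanSpace ℝ (Fin 2)) 1,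
      TopologicalSpace.SeparableSpace (LipschitzFree o) ∧
      ¬ PropertyA (LipschitzFree o) ∧
      Metric.closedBall (0 : LipschitzFree o) 1 =
        closure (convexHull ℝ
          (stronglyExposedPoints (Metric.closedBall (0 : LipschitzFree o) 1)))) ∧
    (∀ (M : Type*) [MetricSpace M] [CompleteSpace M] [TopologicalSpace.SeparableSpace M] (o : M),
      PropertyA (LipschitzFree o) → Dense (LipZero.SNA o)) :=
  ⟨fun o => ⟨(isLipschitzFree_delta o).separableSpace, not_propertyA_lipschitzFree_circle o,
    closedBall_lipschitzFree_circle o⟩,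
  fun _ _ _ _ o hA => (isLipschitzFree_delta o).dense_SNA_of_propertyA hA⟩
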